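/- \textbf{Notation.} Let $n\ge 0$, $[n]=\{1,\dots,n\}$, $\bar I=[n]\setminus I$ for $I\subset[n]$, and let $\mathcal I_k$ be the set of $k$-element subsets of $[n]$. Let $\lambda,y,z_1,\dots,z_n$ be variables, let $\mathbb F=\mathbb C(\lambda,y,z_1,\dots,z_n)$, and let $\mathcal L\subset\mathbb F$ be the algebra of rational functions $f/g$ with $f$ a polynomial and $g$ a finite product of factors $\lambda+ly$ ($l\in\mathbb Z$), $z_i-z_j$ ($i\ne j$), $z_i-z_j-y$. Let $v_1,v_2$ be the standard basis of $\mathbb C^2$; for $I\subset[n]$ let $v_I=v_{i_1}\otimes\dots\otimes v_{i_n}$ with $i_j=1$ if $j\in I$ and $i_j=2$ if $j\notin I$. Let $h(v_1)=1$, $h(v_2)=-1$, and let $h^{(j)}v_{i_1}\otimes\dots\otimes v_{i_n}=h(v_{i_j})\,v_{i_1}\otimes\dots\otimes v_{i_n}$. \textbf{Operators.} In the basis $v_1\otimes v_1,v_1\otimes v_2,v_2\otimes v_1,v_2\otimes v_2$ let \[ R(\lambda,z)=\begin{pmatrix}1&0&0&0\\0&\frac{(\lambda+y)z}{\lambda(z-y)}&-\frac{(\lambda+z)y}{\lambda(z-y)}&0\\0&-\frac{(\lambda-z)y}{\lambda(z-y)}&\frac{(\lambda-y)z}{\lambda(z-y)}&0\\0&0&0&1\end{pmatrix},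 \] and let $R^{(i,i+1)}$ denote its action in the factors $i,i+1$ of $(\mathbb C^2)^{\otimes n}$. Let $P^{(i,i+1)}$ exchange the factors $i$ and $i+1$, and let $K^{(i,i+1)}$ exchange the variables $z_i$ and $z_{i+1}$ in vector-valued rational functions. For $1\le i<n$ put \[ \tilde s_i=R^{(i,i+1)}\Bigl(\lambda-y\sum_{m=i+2}^n h^{(m)},\,z_i-z_{i+1}\Bigr)\circ P^{(i,i+1)}\circ K^{(i,i+1)}, \] where $R^{(i,i+1)}(\lambda-y\sum_m h^{(m)},\cdot)$ acts on $v_J$ with $\sum_{m\ge i+2}h^{(m)}v_J=\mu v_J$ as $R^{(i,i+1)}(\lambda-y\mu,\cdot)$. These are $\mathbb C$-linear operators on $(\mathbb C^2)^{\otimes n}\otimes\mathbb F$. \textbf{Vectors.} For $I=\{i_1<\dots<i_k\}\in\mathcal I_k$ and $i\in[n]$ let $w(i,I)=-\#\{j>i: j\in\bar I\}+\#\{j>i: j\in I\}$, and let \[ W_I(\lambda,t,z,y)=y^k\sum_{\tau\in S_k}\Bigl(\prod_{r=1}^k\prod_{a=1}^n l_I(r,a)\prod_{1\le a<b\le k}\frac{t_a-t_b+y}{t_a-t_b}\Bigr)\Big|_{t_a\mapsto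 t_{\tau(a)}}, \] where $l_I(r,a)=t_r-z_a+y$ if $a<i_r$, $l_I(r,a)=\lambda+t_r-z_a-w(i_r,I)y$ if $a=i_r$, and $l_I(r,a)=t_r-z_a$ if $a>i_r$. Put \[ W_{\sigma,I}(\lambda,t,z,y)=W_{\sigma^{-1}(I)}(\lambda,t,z_{\sigma(1)},\dots,z_{\sigma(n)},y)\qquad(\sigma\in S_n), \] \[ \tilde W^-_J(\lambda,t,z,y)=\frac{(-1)^k}{\prod_{a,b=1}^k(t_a-t_b+y)}\,W_{s_0,J}(-\lambda-(n-2k)y,t,z,y),\qquad s_0(i)=n+1-i, \] \[ \xi_I=\prod_{a\in I}\prod_{b\in\bar I}\frac1{z_a-z_b+y}\ \sum_{J\in\mathcal I_k}\tilde W^-_J(\lambda,z_I,z,y)\,v_J, \] where $z_I$ means the substitution $\{t_1,\dots,t_k\}\mapsto\{z_a: a\in I\}$. \textbf{Proposition.} (1) The operators $\tilde s_i$ satisfy $\tilde s_i^2=1$, $\tilde s_{i+1}\tilde s_i\tilde s_{i+1}=\tilde s_i\tilde s_{i+1}\tilde s_i$, and $\tilde s_i\tilde s_j=\tilde s_j\tilde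 s_i$ for $|i-j|>1$; hence there is a unique action of $S_n$ on $(\mathbb C^2)^{\otimes n}\otimes\mathbb F$ by $\mathbb C$-linear operators in which each simple transposition $s_i=(i,i+1)$ acts as $\tilde s_i$. This action preserves $(\mathbb C^2)^{\otimes n}\otimes\mathcal L$. Moreover $\tilde s_i z_i=z_{i+1}\tilde s_i$, $\tilde s_i z_{i+1}=z_i\tilde s_i$, and $\tilde s_i z_j=z_j\tilde s_i$ for $j\ne i,i+1$, where $z_j$ denotes the operator of multiplication by $z_j$. (2) For all $0\le k\le n$ and $I\in\mathcal I_k$ we have $\xi_I\in(\mathbb C^2)^{\otimes n}\otimes\mathcal L$, and for all $1\le i<n$ \[ \xi_{s_i(I)}=\tilde s_i\,\xi_I . \] -/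

import Mathlib

open scoped TensorProduct

noncomputable section

namespace DynXi

/-! ### Index sets -/

/-- `Subsets n k` is the set of `k`-element subsets of `{1, …, n}`, modelled on `Fin n`. -/
abbrev Subsets (n k : ℕ) : Type := {I : Finset (Fin n) // I.card = k}

/-- `σ(I) = {σ(i) : i ∈ I}`. -/
def permSubset {n k : ℕ} (σ : Equiv.Perm (Fin n)) (I : Subsets n k) : Subsets n k :=
  ⟨I.1.map σ.toEmbedding, by rw [Finset.card_map]; exact I.2⟩

/-- The simple transposition of the (0-based) positions `i` and `i + 1`. -/
def simpleRefl {n : ℕ} (i : ℕ) (hi : i + 1 < n) : Equiv.Perm (Fin n) :=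
  Equiv.swap ⟨i, by omega⟩ ⟨i + 1, hi⟩

/-- `elt I r` is the `r`-th smallest element `i_r` of `I = {i_1 < … < i_k}`. -/
def elt {n k : ℕ} (I : Subsets n k) (r : Fin k) : Fin n :=
  I.1.orderEmbOfFin I.2 r

/-! ### Weight functions

The weight functions are rational functions of `λ, t, z, y`; they are written as functions of values
of these variables in an arbitrary field, and are used below only at values where all their
denominators are nonzero. -/

/-- `w(i, I) = -#{j > i : j ∉ I} + #{j > i : j ∈ I}`. -/
def wt {n k : ℕ} (i : Fin n) (I : Subsets n k) : ℤ :=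
  -((Finset.univ.filter fun j : Fin n => i < j ∧ j ∉ I.1).card : ℤ) +
    ((Finset.univ.filter fun j : Fin n => i < j ∧ j ∈ I.1).card : ℤ)

section Weight

variable {K : Type*} [Field K] {n k : ℕ}

/-- The factor `l_I(r, a)`. -/
def lFactor (I : Subsets n k) (lam : K) (t : Fin k → K) (z : Fin n → K) (y : K)
    (r : Fin k) (a : Fin n) : K :=
  if a < elt I r then t r - z a + y
  else if a = elt I r then lam + t r - z a - (wt (elt I r) I : K) * y
  else t r - z a

/-- The weight function `W_I(λ, t, z, y)`, the symmetrization over `S_k` being written out. -/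
def W (I : Subsets n k) (lam : K) (t : Fin k → K) (z : Fin n → K) (y : K) : K :=
  y ^ k * ∑ τ : Equiv.Perm (Fin k),
    ((∏ r : Fin k, ∏ a : Fin n, lFactor I lam (t ∘ τ) z y r a) *
      ∏ a : Fin k, ∏ b ∈ Finset.Ioi a, (t (τ a) - t (τ b) + y) / (t (τ a) - t (τ b)))

/-- `W_{σ,I}(λ, t, z, y) = W_{σ⁻¹(I)}(λ, t, z_{σ(1)}, …, z_{σ(n)}, y)`. -/
def WPerm (σ : Equiv.Perm (Fin n)) (I : Subsets n k) (lam : K) (t : Fin k → K) (z : Fin n → K)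
    (y : K) : K :=
  W (permSubset σ⁻¹ I) lam t (z ∘ σ) y

/-- `e_k(t, y) = ∏_{a, b} (t_a - t_b + y)`. -/
def eK (t : Fin k → K) (y : K) : K := ∏ a : Fin k, ∏ b : Fin k, (t a - t b + y)

/-- The modified weight function
`W̃⁻_J = (-1)^k / e_k · W_{s₀,J}(-λ - (n - 2k) y, t, z, y)`, with `s₀` the longest permutation. -/
def WMinus (J : Subsets n k) (lam : K) (t : Fin k → K) (z : Fin n → K) (y : K) : K :=
  (-1) ^ k / eK t y * WPerm Fin.revPerm J (-lam - ((n : K) - 2 * (k : K)) * y) t z y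

/-- `Q_I(z, y) = ∏_{a ∈ I} ∏_{b ∉ I} (z_a - z_b + y)`. -/
def Q (I : Subsets n k) (z : Fin n → K) (y : K) : K :=
  ∏ a ∈ I.1, ∏ b ∈ I.1ᶜ, (z a - z b + y)

/-- The rational dynamical R-matrix in the basis `v₁⊗v₁, v₁⊗v₂, v₂⊗v₁, v₂⊗v₂`
(the columns are the images of the basis vectors); `v₁, v₂` have indices `0, 1`. -/
def dynR (lam z y : K) : Matrix (Fin 2 × Fin 2) (Fin 2 × Fin 2) K :=
  (!![1, 0, 0, 0;
      0, (lam + y) * z / (lam * (z - y)), -((lam + z) * y) / (lam * (z - y)), 0;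
      0, -((lam - z) * y) / (lam * (z - y)), (lam - y) * z / (lam * (z - y)), 0;
      0, 0, 0, 1] : Matrix (Fin 4) (Fin 4) K).submatrix finProdFinEquiv finProdFinEquiv

end Weight

/-! ### Rational functions -/

/-- The variables `λ, y, z₁, …, zₙ`. -/
inductive Var (n : ℕ) : Type
  | lam : Var n
  | y : Var n
  | z (i : Fin n) : Var n

/-- The field of all rational functions in `λ, y, z₁, …, zₙ` over `ℂ`. -/
abbrev F (n : ℕ) : Type := FractionRing (MvPolynomial (Var n) ℂ)

/-- A variable as a rational function. -/
def X {n : ℕ} (v : Var n) : F n := algebraMap (MvPolynomial (Var n) ℂ) (F n) (MvPolynomial.X v)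

/-- The rational function `λ`. -/
def lamF (n : ℕ) : F n := X Var.lam

/-- The rational function `y`. -/
def yF (n : ℕ) : F n := X Var.y

/-- The rational functions `z₁, …, zₙ`. -/
def zF (n : ℕ) (i : Fin n) : F n := X (Var.z i)

/-- The permitted denominators: products of factors `λ + l y` (`l ∈ ℤ`), `z_i - z_j` (`i ≠ j`)
and `z_i - z_j - y`. -/
def denoms (n : ℕ) : Submonoid (MvPolynomial (Var n) ℂ) :=
  Submonoid.closure
    ({p | ∃ l : ℤ, p = MvPolynomial.X Var.lam + (l : MvPolynomial (Var n) ℂ) * MvPolynomial.X Var.y} ∪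
     {p | ∃ i j : Fin n, i ≠ j ∧ p = MvPolynomial.X (Var.z i) - MvPolynomial.X (Var.z j)} ∪
     {p | ∃ i j : Fin n,
        p = MvPolynomial.X (Var.z i) - MvPolynomial.X (Var.z j) - MvPolynomial.X Var.y})

lemma denoms_le (n : ℕ) : denoms n ≤ nonZeroDivisors (MvPolynomial (Var n) ℂ) := by
  classical
  refine Submonoid.closure_le.2 ?_
  rintro p ((⟨l, rfl⟩ | ⟨i, j, hij, rfl⟩) | ⟨i, j, rfl⟩) <;>
    refine mem_nonZeroDivisors_of_ne_zero fun h => ?_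
  · have := congrArg (MvPolynomial.eval fun v : Var n => match v with
      | Var.lam => (1 : ℂ) | _ => 0) h
    simp at this
  · have := congrArg (MvPolynomial.eval fun v : Var n => match v with
      | Var.z a => if a = i then (1 : ℂ) else 0 | _ => 0) h
    simp [hij.symm] at this
  · have := congrArg (MvPolynomial.eval fun v : Var n => match v with
      | Var.y => (1 : ℂ) | _ => 0) h
    simp at this

/-- The algebra `L_{λ,z,y}` of the rational functions `f / g` with `f` a polynomial and `g` a
permitted denominator. -/
def L (n : ℕ) : Subalgebra ℂ (F n) :=
  (Localization.subalgebra.ofField (F n) (denoms n) (denoms_le n)).restrictScalars ℂ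

/-- The permutation of variables `z_a ↦ z_{σ(a)}`, fixing `λ` and `y`. -/
def permVar {n : ℕ} (σ : Equiv.Perm (Fin n)) : Equiv.Perm (Var n) where
  toFun v := match v with
    | Var.lam => Var.lam
    | Var.y => Var.y
    | Var.z i => Var.z (σ i)
  invFun v := match v with
    | Var.lam => Var.lam
    | Var.y => Var.y
    | Var.z i => Var.z (σ.symm i)
  left_inv v := by cases v <;> simp
  right_inv v := by cases v <;> simp

/-- The substitution `z_a ↦ z_{σ(a)}` on rational functions. -/
def substZ {n : ℕ} (σ : Equiv.Perm (Fin n)) : F n ≃ₐ[ℂ] F n :=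
  IsFractionRing.algEquivOfAlgEquiv (MvPolynomial.renameEquiv ℂ (permVar σ))

/-! ### The tensor space -/

/-- `(ℂ²)^{⊗ n}`. -/
abbrev C2pow (n : ℕ) : Type := ⨂[ℂ] _ : Fin n, (Fin 2 → ℂ)

/-- `(ℂ²)^{⊗ n}` with coefficients in the field of rational functions. -/
abbrev V (n : ℕ) : Type := F n ⊗[ℂ] C2pow n

/-- The basis of elementary tensors `v_{w(1)} ⊗ … ⊗ v_{w(n)}`. -/
def vBasis (n : ℕ) : Module.Basis (Fin n → Fin 2) (F n) (V n) :=
  Algebra.TensorProduct.basis (F n) (Basis.piTensorProduct fun _ : Fin n => Pi.basisFun ℂ (Fin 2))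

lemma vBasis_apply (n : ℕ) (w : Fin n → Fin 2) :
    vBasis n w = 1 ⊗ₜ[ℂ] (⨂ₜ[ℂ] j, (Pi.single (w j) 1 : Fin 2 → ℂ)) := by
  simp [vBasis, Algebra.TensorProduct.basis_apply, Basis.piTensorProduct_apply]

/-- `v_I`, whose `j`-th factor is `v₁` if `j ∈ I` and `v₂` otherwise. -/
def vI {n : ℕ} (I : Finset (Fin n)) : V n := vBasis n fun j => if j ∈ I then 0 else 1

/-- `(ℂ²)^{⊗ n} ⊗ L_{λ,z,y}`, as a subspace of `(ℂ²)^{⊗ n}` with rational function coefficients. -/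
def lattice (n : ℕ) : Submodule ℂ (V n) :=
  LinearMap.range (LinearMap.rTensor (C2pow n) (L n).val.toLinearMap)

/-- `h(v₁) = 1`, `h(v₂) = -1`. -/
def hwt (a : Fin 2) : ℤ := if a = 0 then 1 else -1

/-- `R^{(i,j)}(λ - y ∑_{m ∈ S} h^{(m)}, x)`: the R-matrix acts in the factors `i` and `j`
(intended for `i ≠ j` and `i, j ∉ S`), with its dynamical parameter shifted by the weights of the
factors in `S`. -/
def RAt {n : ℕ} (i j : Fin n) (S : Finset (Fin n)) (x : F n) : V n →ₗ[F n] V n :=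
  (vBasis n).constr (F n) fun w =>
    ∑ p : Fin 2 × Fin 2,
      dynR (lamF n - yF n * ∑ m ∈ S, (hwt (w m) : F n)) x (yF n) p (w i, w j) •
        vBasis n (Function.update (Function.update w i p.1) j p.2)

/-- Permutation of the tensor factors: the factor in position `a` moves to position `σ(a)`. -/
def permFactors {n : ℕ} (σ : Equiv.Perm (Fin n)) : V n →ₗ[ℂ] V n :=
  LinearMap.lTensor (F n)
    (PiTensorProduct.reindex ℂ (fun _ : Fin n => (Fin 2 → ℂ)) σ).toLinearMap

/-- The substitution `z_a ↦ z_{σ(a)}` in vector-valued rational functions. -/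
def substV {n : ℕ} (σ : Equiv.Perm (Fin n)) : V n →ₗ[ℂ] V n :=
  LinearMap.rTensor (C2pow n) (substZ σ).toAlgHom.toLinearMap

/-- `s̃_i = R^{(i,i+1)}(λ - y ∑_{m ≥ i+2} h^{(m)}, z_i - z_{i+1}) ∘ P^{(i,i+1)} ∘ K^{(i,i+1)}`. -/
def sTilde {n : ℕ} (i : ℕ) (hi : i + 1 < n) : V n →ₗ[ℂ] V n :=
  (RAt ⟨i, by omega⟩ ⟨i + 1, hi⟩ (Finset.univ.filter fun m : Fin n => i + 2 ≤ (m : ℕ))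
      (zF n ⟨i, by omega⟩ - zF n ⟨i + 1, hi⟩)).restrictScalars ℂ ∘ₗ
    permFactors (simpleRefl i hi) ∘ₗ substV (simpleRefl i hi)

/-! ### The vectors `ξ_I` -/

/-- `ξ_I = Q_I(z, y)⁻¹ ∑_J W̃⁻_J(λ, z_I, z, y) v_J`, with `z_I = (z_a)_{a ∈ I}`. -/
def xi {n k : ℕ} (I : Subsets n k) : V n :=
  (Q I (zF n) (yF n))⁻¹ •
    ∑ J : Subsets n k, WMinus J (lamF n) (fun r => zF n (elt I r)) (zF n) (yF n) • vI J.1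

end DynXi

end

/-!
The coefficient of `v_J` in `ξ_I` is, up to the factor `1 / Q_I`, the weight function `W̃⁻_J` at
`t = z_I`. Comparing the coefficients of `v_J` in `s̃_i ξ_I = ξ_{s_i(I)}` leaves two cases. If `J`
contains both or neither of `i`, `i + 1`, the claim is that `W̃⁻_J` is symmetric in
`z_i, z_{i+1}`. Otherwise it is a three-term relation between `W̃⁻_J`, `W̃⁻_{s_i(J)}` and their
transforms under `z_i ↔ z_{i+1}`. In both cases only the factors `l_J(r, i)`, `l_J(r, i + 1)` are
affected, so that after symmetrization each claim becomes an identity of rational functions in at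
most two of the variables `t_r`.

At `t = z_I` the weight functions are triangular, hence the vectors `ξ_I`, `I ⊂ [n]`, form a basis
over `𝔽`. Permuting this basis together with the variables `z_a` defines an action of `S_n`. Both
`s̃_i` and the action of `s_i` are semilinear over `z_i ↔ z_{i+1}` and send `ξ_I` to `ξ_{s_i(I)}`,
so they coincide. The relations between the `s̃_i` are therefore inherited from `S_n`, without any
use of the dynamical Yang–Baxter equation.
-/

noncomputable section

namespace DynXi

/-! ### Transpositions of adjacent elements -/

section CovBy

variable {α : Type*} [LinearOrder α] {a b c d : α}

lemma swap_lt_iff (hab : a ⋖ b) (hcb : c ≠ b) : Equiv.swap a b d < c ↔ d < c := by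
  have h : a < c ↔ b ≤ c := hab.lt_iff_le_right
  grind [hab.lt]

lemma lt_swap_iff (hab : a ⋖ b) (hca : c ≠ a) : c < Equiv.swap a b d ↔ c < d := by
  have h : c < b ↔ c ≤ a := hab.lt_iff_le_left
  grind [hab.lt]

lemma swap_lt_swap (hab : a ⋖ b) (hcd : c < d) (hne : ¬(c = a ∧ d = b)) :
    Equiv.swap a b c < Equiv.swap a b d := by
  have h₁ : c < b ↔ c ≤ a := hab.lt_iff_le_left
  have h₂ : a < d ↔ b ≤ d := hab.lt_iff_le_right
  grind [hab.lt]

lemma Ioi_eq_insert_of_covBy [LocallyFiniteOrderTop α] (hab : a ⋖ b) :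
    Finset.Ioi a = insert b (Finset.Ioi b) := by
  rw [Finset.Ioi_insert]
  ext c
  simp only [Finset.mem_Ioi, Finset.mem_Ici, hab.lt_iff_le_right]

end CovBy

section Swap

variable {α M : Type*} [DecidableEq α] {a b p : α}

lemma swap_eq_iff_of_ne (ha : p ≠ a) (hb : p ≠ b) (q : α) : Equiv.swap a b q = p ↔ q = p := by
  rw [Equiv.swap_apply_eq_iff, Equiv.swap_apply_of_ne_of_ne ha hb]

lemma prod_eq_mul_prod_compl_pair [Fintype α] [CommMonoid M] (hab : a ≠ b) (f : α → M) :
    ∏ q, f q = f a * f b * ∏ q ∈ ({a, b} : Finset α)ᶜ, f q := by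
  rw [← Finset.prod_pair hab, Finset.prod_mul_prod_compl]

lemma prod_compl_pair_congr [Fintype α] [CommMonoid M] {f g : α → M}
    (hfg : ∀ q, q ≠ a → q ≠ b → f q = g q) :
    ∏ q ∈ ({a, b} : Finset α)ᶜ, f q = ∏ q ∈ ({a, b} : Finset α)ᶜ, g q :=
  Finset.prod_congr rfl fun q hq => by
    simp only [Finset.mem_compl, Finset.mem_insert, Finset.mem_singleton, not_or] at hq
    exact hfg q hq.1 hq.2

end Swap

/-! ### Subsets and their words -/

/-- The sequence of indices of the tensor factors of `v_I`: the letter is `0` at the positions in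
`I` and `1` at the others. -/
def word {n : ℕ} (I : Finset (Fin n)) : Fin n → Fin 2 := fun j => if j ∈ I then 0 else 1

section Subsets

variable {n k : ℕ} {a b j p : Fin n}

lemma word_injective : Function.Injective (word (n := n)) := fun I J h => by
  ext j
  have := congrFun h j
  simp only [word] at this
  split_ifs at this <;> simp_all

lemma mem_permSubset (σ : Equiv.Perm (Fin n)) (I : Subsets n k) (j : Fin n) :
    j ∈ (permSubset σ I).1 ↔ σ⁻¹ j ∈ I.1 :=
  Finset.mem_map_equiv

lemma permSubset_swap_swap (a b : Fin n) (I : Subsets n k) :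
    permSubset (Equiv.swap a b) (permSubset (Equiv.swap a b) I) = I := by
  ext j
  simp only [mem_permSubset, Equiv.swap_inv, Equiv.swap_apply_self]

lemma word_permSubset (σ : Equiv.Perm (Fin n)) (I : Subsets n k) :
    word (permSubset σ I).1 = word I.1 ∘ ⇑σ⁻¹ := by
  ext j
  simp only [word, mem_permSubset, Function.comp_apply]

lemma elt_mem (I : Subsets n k) (r : Fin k) : elt I r ∈ I.1 :=
  Finset.orderEmbOfFin_mem _ _ _

lemma elt_injective (I : Subsets n k) : Function.Injective (elt I) :=
  (I.1.orderEmbOfFin I.2).injective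

lemma exists_elt_eq {I : Subsets n k} (hj : j ∈ I.1) : ∃ r, elt I r = j := by
  rwa [← Finset.mem_coe, ← Finset.range_orderEmbOfFin I.1 I.2] at hj

lemma sum_elt {M : Type*} [AddCommMonoid M] (I : Subsets n k) (f : Fin n → M) :
    ∑ r, f (elt I r) = ∑ j ∈ I.1, f j := by
  conv_rhs => rw [← Finset.map_orderEmbOfFin_univ I.1 I.2, Finset.sum_map]
  rfl

lemma exists_comp_elt_eq (σ : Equiv.Perm (Fin n)) (I : Subsets n k) :
    ∃ π : Equiv.Perm (Fin k), σ ∘ elt I = elt (permSubset σ I) ∘ π := by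
  have hmem (r : Fin k) : ∃ r', elt (permSubset σ I) r' = σ (elt I r) :=
    exists_elt_eq (Finset.mem_map_of_mem _ (elt_mem I r))
  choose f hf using hmem
  have hinj : Function.Injective f := fun r r' h =>
    elt_injective I (σ.injective (by rw [← hf, ← hf, h]))
  exact ⟨Equiv.ofBijective f (Finite.injective_iff_bijective.1 hinj), funext fun r => (hf r).symm⟩

lemma elt_permSubset_swap (hab : a ⋖ b) {I : Subsets n k} (h : ¬(a ∈ I.1 ∧ b ∈ I.1))
    (r : Fin k) : elt (permSubset (Equiv.swap a b) I) r = Equiv.swap a b (elt I r) := by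
  have hmono : StrictMono fun r => Equiv.swap a b (elt I r) := fun p q hpq =>
    swap_lt_swap hab ((I.1.orderEmbOfFin I.2).strictMono hpq) fun h' =>
      h ⟨h'.1 ▸ elt_mem I p, h'.2 ▸ elt_mem I q⟩
  exact (congrFun (Finset.orderEmbOfFin_unique (permSubset (Equiv.swap a b) I).2
    (fun r => Finset.mem_map_of_mem _ (elt_mem I r)) hmono) r).symm

lemma wt_eq_sum (p : Fin n) (I : Subsets n k) :
    wt p I = ∑ j ∈ Finset.Ioi p, hwt (word I.1 j) := by
  have h (j : Fin n) :
      hwt (word I.1 j) = -(if j ∉ I.1 then 1 else 0) + if j ∈ I.1 then 1 else 0 := by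
    by_cases hj : j ∈ I.1 <;> simp [hwt, word, hj]
  simp only [wt, h, Finset.sum_add_distrib, Finset.sum_neg_distrib, Finset.sum_boole,
    ← Finset.filter_lt_eq_Ioi, Finset.filter_filter]

lemma wt_eq_of_covBy (hab : a ⋖ b) (I : Subsets n k) :
    wt a I = hwt (word I.1 b) + wt b I := by
  rw [wt_eq_sum, wt_eq_sum, Ioi_eq_insert_of_covBy hab, Finset.sum_insert (by simp)]

lemma wt_permSubset_swap (hab : a ⋖ b) (hp : p ≠ a) (I : Subsets n k) :
    wt p (permSubset (Equiv.swap a b) I) = wt p I := by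
  simp only [wt_eq_sum, word_permSubset, Equiv.swap_inv, Function.comp_apply]
  exact Finset.sum_equiv (Equiv.swap a b)
    (fun j => by simp only [Finset.mem_Ioi, lt_swap_iff hab hp]) fun _ _ => rfl

lemma sum_hwt_word (I : Subsets n k) : ∑ j, hwt (word I.1 j) = 2 * k - n := by
  have h (j : Fin n) : hwt (word I.1 j) = 2 * (if j ∈ I.1 then 1 else 0) - 1 := by
    by_cases hj : j ∈ I.1 <;> simp [hwt, word, hj]
  simp [h, I.2, mul_comm]

end Subsets

/-! ### Symmetrizations -/

section Symmetrization

variable {K : Type*} [Field K] {k : ℕ} (y : K) (t : Fin k → K)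

/-- The kernel `∏_{r < s} (t_r - t_s + y) / (t_r - t_s)` of the symmetrization defining the weight
functions. -/
def pairProd : K := ∏ r : Fin k, ∏ s ∈ Finset.Ioi r, (t r - t s + y) / (t r - t s)

/-- The factors of `pairProd` other than the one at `(r, s)`. -/
def pairRest (r s : Fin k) : K :=
  ∏ p ∈ (Finset.univ.filter fun p : Fin k × Fin k => p.1 < p.2).erase (r, s),
    (t p.1 - t p.2 + y) / (t p.1 - t p.2)

/-- The symmetrization
`∑_τ ∏_r f_r(t_{τ(r)}) ∏_{r < s} (t_{τ(r)} - t_{τ(s)} + y) / (t_{τ(r)} - t_{τ(s)})`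
over `τ ∈ S_k`, as a multilinear function of `f_1, …, f_k`. -/
def symSum : MultilinearMap K (fun _ : Fin k => K → K) K :=
  ∑ τ : Equiv.Perm (Fin k), pairProd y (t ∘ τ) •
    (MultilinearMap.mkPiAlgebra K (Fin k) K).compLinearMap fun r => LinearMap.proj (t (τ r))

lemma symSum_apply (f : Fin k → K → K) :
    symSum y t f = ∑ τ : Equiv.Perm (Fin k), (∏ r, f r (t (τ r))) * pairProd y (t ∘ τ) := by
  simp [symSum, mul_comm]

lemma symSum_comp_perm (π : Equiv.Perm (Fin k)) : symSum y (t ∘ π) = symSum y t := by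
  ext f
  rw [symSum_apply, symSum_apply]
  exact Equiv.sum_comp (Equiv.mulLeft π) fun τ : Equiv.Perm (Fin k) =>
    (∏ r, f r (t (τ r))) * pairProd y (t ∘ τ)

variable {r s : Fin k}

lemma pairProd_eq_mul_pairRest (hrs : r < s) :
    pairProd y t = (t r - t s + y) / (t r - t s) * pairRest y t r s := by
  have hmem : (r, s) ∈ Finset.univ.filter fun p : Fin k × Fin k => p.1 < p.2 := by simpa using hrs
  rw [pairRest, Finset.mul_prod_erase _ (fun p : Fin k × Fin k =>
    (t p.1 - t p.2 + y) / (t p.1 - t p.2)) hmem, pairProd, Finset.prod_filter,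
    Fintype.prod_prod_type]
  simp only [← Finset.prod_filter, Finset.filter_lt_eq_Ioi]

lemma pairRest_comp_swap (hrs : r ⋖ s) :
    pairRest y (t ∘ Equiv.swap r s) r s = pairRest y t r s := by
  have hmaps (p) (hp : p ∈ (Finset.univ.filter fun p : Fin k × Fin k => p.1 < p.2).erase (r, s)) :
      p.map (Equiv.swap r s) (Equiv.swap r s) ∈
        (Finset.univ.filter fun p : Fin k × Fin k => p.1 < p.2).erase (r, s) := by
    simp only [Finset.mem_erase, Finset.mem_filter, Finset.mem_univ, true_and, ne_eq,
      Prod.ext_iff, Prod.map_fst, Prod.map_snd, Equiv.swap_apply_eq_iff, Equiv.swap_apply_left,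
      Equiv.swap_apply_right] at hp ⊢
    exact ⟨fun h => (h.1 ▸ h.2 ▸ hp.2 : s < r).not_gt hrs.lt, swap_lt_swap hrs hp.2 hp.1⟩
  exact Finset.prod_bij' (fun p _ => p.map (Equiv.swap r s) (Equiv.swap r s))
    (fun p _ => p.map (Equiv.swap r s) (Equiv.swap r s)) hmaps hmaps
    (fun _ _ => Prod.ext (by simp) (by simp))
    (fun _ _ => Prod.ext (by simp) (by simp)) fun _ _ => rfl

variable {y} in
/-- The terms at `τ` and `τ (r s)` cancel in the difference of the two sides, because
`1 / (u - v) + 1 / (v - u) = 0`. -/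
lemma symSum_congr_of_covBy (hrs : r ⋖ s) {f g : Fin k → K → K}
    (hfg : ∀ q, q ≠ r → q ≠ s → f q = g q)
    (hsymm : ∀ u v, (f r u * f s v - g r u * g s v) * (u - v + y) =
      (f r v * f s u - g r v * g s u) * (v - u + y)) :
    symSum y t f = symSum y t g := by
  rw [symSum_apply, symSum_apply, ← sub_eq_zero, ← Finset.sum_sub_distrib]
  refine Finset.sum_involution (fun τ _ => τ * Equiv.swap r s) (fun τ _ => ?_)
    (fun τ _ _ h => hrs.lt.ne (Equiv.swap_eq_one_iff.1 (mul_eq_left.1 h)))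
    (fun _ _ => Finset.mem_univ _)
    (fun τ _ => by simp only [mul_assoc, Equiv.swap_mul_self, mul_one])
  have hrest (h : Fin k → K → K) : ∏ q ∈ ({r, s} : Finset (Fin k))ᶜ,
      h q (t (τ (Equiv.swap r s q))) = ∏ q ∈ ({r, s} : Finset (Fin k))ᶜ, h q (t (τ q)) :=
    prod_compl_pair_congr fun q hr hs => by rw [Equiv.swap_apply_of_ne_of_ne hr hs]
  have hrest' : ∏ q ∈ ({r, s} : Finset (Fin k))ᶜ, f q (t (τ q)) =
      ∏ q ∈ ({r, s} : Finset (Fin k))ᶜ, g q (t (τ q)) :=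
    prod_compl_pair_congr fun q hr hs => by rw [hfg q hr hs]
  have hpair : pairRest y (t ∘ (τ * Equiv.swap r s)) r s = pairRest y (t ∘ τ) r s :=
    pairRest_comp_swap y (t ∘ τ) hrs
  simp only [prod_eq_mul_prod_compl_pair hrs.lt.ne, pairProd_eq_mul_pairRest y _ hrs.lt, hpair,
    Function.comp_apply, Equiv.Perm.mul_apply, hrest, hrest', Equiv.swap_apply_left,
    Equiv.swap_apply_right]
  have hinv : (t (τ s) - t (τ r))⁻¹ = -(t (τ r) - t (τ s))⁻¹ := by rw [← inv_neg, neg_sub]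
  rw [div_eq_mul_inv, div_eq_mul_inv, hinv]
  linear_combination (∏ q ∈ ({r, s} : Finset (Fin k))ᶜ, g q (t (τ q))) *
    pairRest y (t ∘ τ) r s * (t (τ r) - t (τ s))⁻¹ * hsymm (t (τ r)) (t (τ s))

end Symmetrization

/-! ### Weight functions -/

section WeightFunctions

variable {K : Type*} [Field K] {n k : ℕ} {a b : Fin n}

/-- The product over `q` of the factors `l_I(r, q)` of a weight function, as a function of the
variable `x = t_r`; here `p` and `c` stand for `i_r` and `w(i_r, I)`. -/
def rowProd (lam y : K) (z : Fin n → K) (p : Fin n) (c : ℤ) (x : K) : K :=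
  ∏ q : Fin n, if q < p then x - z q + y else if q = p then lam + x - z q - (c : K) * y
    else x - z q

/-- The factors of `rowProd` at the positions other than `a` and `b`, for adjacent `a < b` and
`p ∈ {a, b}`. -/
def rowRest (y : K) (z : Fin n → K) (a b : Fin n) (x : K) : K :=
  ∏ q ∈ ({a, b} : Finset (Fin n))ᶜ, if q < a then x - z q + y else x - z q

/-- The product `∏_q l_I(r, q)` as a function of `t_r`. -/
def row (I : Subsets n k) (lam y : K) (z : Fin n → K) (r : Fin k) : K → K :=
  rowProd lam y z (elt I r) (wt (elt I r) I)

/-- The factors of `rowProd` at the adjacent positions `p = a` and `b`, with `u = z_a`, `v = z_b`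
and `m = λ - (c + 1) y`. -/
def leftFactor (m y u v x : K) : K := (m + x - u + y) * (x - v)

/-- The factors of `rowProd` at the adjacent positions `a` and `p = b`, with `u = z_a`, `v = z_b`
and `m = λ - c y`. -/
def rightFactor (m y u v x : K) : K := (x - u + y) * (m + x - v)

lemma W_eq_symSum (I : Subsets n k) (lam : K) (t : Fin k → K) (z : Fin n → K) (y : K) :
    W I lam t z y = y ^ k * symSum y t (row I lam y z) := by
  rw [symSum_apply]
  rfl

lemma W_comp_perm (I : Subsets n k) (lam : K) (t : Fin k → K) (z : Fin n → K) (y : K)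
    (π : Equiv.Perm (Fin k)) : W I lam (t ∘ π) z y = W I lam t z y := by
  rw [W_eq_symSum, W_eq_symSum, symSum_comp_perm]

lemma rowProd_comp_swap (hab : a ⋖ b) (lam y : K) (z : Fin n → K) {p : Fin n}
    (ha : p ≠ a) (hb : p ≠ b) (c : ℤ) :
    rowProd lam y (z ∘ Equiv.swap a b) p c = rowProd lam y z p c := by
  ext x
  unfold rowProd
  conv_rhs => rw [← Equiv.prod_comp (Equiv.swap a b)]
  simp only [swap_lt_iff hab hb, swap_eq_iff_of_ne ha hb, Function.comp_apply]

lemma rowRest_comp_swap (y : K) (z : Fin n → K) :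
    rowRest y (z ∘ Equiv.swap a b) a b = rowRest y z a b :=
  funext fun x => prod_compl_pair_congr fun q ha hb => by
    rw [Function.comp_apply, Equiv.swap_apply_of_ne_of_ne ha hb]

lemma rowProd_left (hab : a ⋖ b) (lam y : K) (z : Fin n → K) (c : ℤ) :
    rowProd lam y z a c =
      rowRest y z a b * leftFactor (lam - (c + 1) * y) y (z a) (z b) := by
  ext x
  have hrest : ∏ q ∈ ({a, b} : Finset (Fin n))ᶜ, (if q < a then x - z q + y
      else if q = a then lam + x - z q - (c : K) * y else x - z q) = rowRest y z a b x :=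
    prod_compl_pair_congr fun q ha _ => by rw [if_neg ha]
  rw [rowProd, prod_eq_mul_prod_compl_pair hab.lt.ne, hrest, if_neg (lt_irrefl a), if_pos rfl,
    if_neg hab.lt.not_gt, if_neg hab.lt.ne', Pi.mul_apply, leftFactor]
  ring

lemma rowProd_right (hab : a ⋖ b) (lam y : K) (z : Fin n → K) (c : ℤ) :
    rowProd lam y z b c = rowRest y z a b * rightFactor (lam - c * y) y (z a) (z b) := by
  ext x
  have hrest : ∏ q ∈ ({a, b} : Finset (Fin n))ᶜ, (if q < b then x - z q + y
      else if q = b then lam + x - z q - (c : K) * y else x - z q) = rowRest y z a b x :=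
    prod_compl_pair_congr fun q ha hb => by
      rw [if_neg hb]
      simp only [hab.lt_iff_le_left, le_iff_lt_or_eq, ha, or_false]
  rw [rowProd, prod_eq_mul_prod_compl_pair hab.lt.ne, hrest, if_pos hab.lt, if_neg (lt_irrefl b),
    if_pos rfl, Pi.mul_apply, rightFactor]
  ring

lemma row_comp_swap (hab : a ⋖ b) {I : Subsets n k} {r : Fin k} (ha : elt I r ≠ a)
    (hb : elt I r ≠ b) (lam y : K) (z : Fin n → K) :
    row I lam y (z ∘ Equiv.swap a b) r = row I lam y z r :=
  rowProd_comp_swap hab lam y z ha hb _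

lemma row_permSubset_swap (hab : a ⋖ b) {I : Subsets n k} {r : Fin k} (ha : elt I r ≠ a)
    (hb : b ∉ I.1) (lam y : K) (z : Fin n → K) :
    row (permSubset (Equiv.swap a b) I) lam y z r = row I lam y z r := by
  rw [row, elt_permSubset_swap hab fun h => hb h.2, row,
    Equiv.swap_apply_of_ne_of_ne ha (ne_of_mem_of_not_mem (elt_mem I r) hb),
    wt_permSubset_swap hab ha]

lemma W_comp_swap_of_notMem (hab : a ⋖ b) {I : Subsets n k} (ha : a ∉ I.1) (hb : b ∉ I.1)
    (lam : K) (t : Fin k → K) (z : Fin n → K) (y : K) :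
    W I lam t (z ∘ Equiv.swap a b) y = W I lam t z y := by
  rw [W_eq_symSum, W_eq_symSum, funext fun r => row_comp_swap hab
    (ne_of_mem_of_not_mem (elt_mem I r) ha) (ne_of_mem_of_not_mem (elt_mem I r) hb) lam y z]

lemma W_comp_swap_of_mem (hab : a ⋖ b) {I : Subsets n k} (ha : a ∈ I.1) (hb : b ∈ I.1)
    (lam : K) (t : Fin k → K) (z : Fin n → K) (y : K) :
    W I lam t (z ∘ Equiv.swap a b) y = W I lam t z y := by
  obtain ⟨r, hr⟩ := exists_elt_eq ha
  obtain ⟨s, hs⟩ := exists_elt_eq hb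
  have hrs : r ⋖ s := CovBy.of_image (I.1.orderEmbOfFin I.2) (by rwa [← hr, ← hs] at hab)
  rw [W_eq_symSum, W_eq_symSum]
  congr 1
  refine symSum_congr_of_covBy t hrs (fun q hqr hqs => row_comp_swap hab
    (hr ▸ (elt_injective I).ne hqr) (hs ▸ (elt_injective I).ne hqs) lam y z) fun u v => ?_
  have hwt : wt a I = 1 + wt b I := by
    rw [wt_eq_of_covBy hab, word, if_pos hb]
    rfl
  simp only [row, hr, hs, hwt, rowProd_left hab, rowProd_right hab, rowRest_comp_swap,
    Pi.mul_apply, leftFactor, rightFactor, Function.comp_apply, Equiv.swap_apply_left,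
    Equiv.swap_apply_right]
  push_cast
  ring

/-- The weight function `W_I` with the factors at the adjacent positions `a` and `b` of its `r`-th
row replaced by an arbitrary function of `t_r`, on which it depends linearly; it is meant for
`i_r = a` and `b ∉ I`. -/
def exchangeForm (I : Subsets n k) (r : Fin k) (a b : Fin n) (lam : K) (t : Fin k → K)
    (z : Fin n → K) (y : K) : (K → K) →ₗ[K] K :=
  y ^ k • ((symSum y t).toLinearMap (row I lam y z) r ∘ₗ LinearMap.mulLeft K (rowRest y z a b))

section Exchange

variable {I : Subsets n k} {r : Fin k} (hab : a ⋖ b) (hr : elt I r = a) (hb : b ∉ I.1)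
include hab hr hb

lemma W_eq_exchangeForm (lam : K) (t : Fin k → K) (z : Fin n → K) (y : K) :
    W I lam t z y =
      exchangeForm I r a b lam t z y (leftFactor (lam - wt b I * y) y (z a) (z b)) := by
  have hwt : wt a I = -1 + wt b I := by
    rw [wt_eq_of_covBy hab, word, if_neg hb]
    rfl
  have hrow : row I lam y z r =
      rowRest y z a b * leftFactor (lam - wt b I * y) y (z a) (z b) := by
    rw [row, hr, rowProd_left hab, hwt]
    push_cast
    ring_nf
  rw [W_eq_symSum, exchangeForm, LinearMap.smul_apply, LinearMap.comp_apply,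
    LinearMap.mulLeft_apply, ← hrow, MultilinearMap.toLinearMap_apply, Function.update_eq_self,
    smul_eq_mul]

lemma W_permSubset_swap_eq_exchangeForm (lam : K) (t : Fin k → K) (z : Fin n → K) (y : K) :
    W (permSubset (Equiv.swap a b) I) lam t z y =
      exchangeForm I r a b lam t z y (rightFactor (lam - wt b I * y) y (z a) (z b)) := by
  have hrow : row (permSubset (Equiv.swap a b) I) lam y z = Function.update (row I lam y z) r
      (rowRest y z a b * rightFactor (lam - wt b I * y) y (z a) (z b)) := by
    refine Function.eq_update_iff.2 ⟨?_, fun s hs => ?_⟩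
    · rw [row, elt_permSubset_swap hab fun h => hb h.2, hr, Equiv.swap_apply_left,
        wt_permSubset_swap hab hab.lt.ne', rowProd_right hab]
    · exact row_permSubset_swap hab (hr ▸ (elt_injective I).ne hs) hb lam y z
  rw [W_eq_symSum, hrow, exchangeForm, LinearMap.smul_apply, LinearMap.comp_apply,
    LinearMap.mulLeft_apply, MultilinearMap.toLinearMap_apply, smul_eq_mul]

lemma exchangeForm_comp_swap (lam : K) (t : Fin k → K) (z : Fin n → K) (y : K) :
    exchangeForm I r a b lam t (z ∘ Equiv.swap a b) y = exchangeForm I r a b lam t z y := by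
  ext1 g
  have hrow : Function.update (row I lam y (z ∘ Equiv.swap a b)) r (rowRest y z a b * g) =
      Function.update (row I lam y z) r (rowRest y z a b * g) := by
    refine Function.update_eq_iff.2 ⟨by rw [Function.update_self], fun s hs => ?_⟩
    rw [Function.update_of_ne hs, row_comp_swap hab
      (hr ▸ (elt_injective I).ne hs) (ne_of_mem_of_not_mem (elt_mem I s) hb)]
  simp only [exchangeForm, LinearMap.smul_apply, LinearMap.comp_apply, LinearMap.mulLeft_apply,
    MultilinearMap.toLinearMap_apply, rowRest_comp_swap, hrow]

end Exchange

/-! ### Triangularity of weight functions -/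

lemma rowProd_eq_zero_of_lt {p q : Fin n} (hpq : p < q) (lam y : K) (z : Fin n → K) (c : ℤ) :
    rowProd lam y z p c (z q) = 0 :=
  Finset.prod_eq_zero (Finset.mem_univ q) (by rw [if_neg hpq.not_gt, if_neg hpq.ne', sub_self])

lemma elt_le_of_prod_row_ne_zero {I J : Subsets n k} {lam y : K} {z : Fin n → K}
    {τ : Equiv.Perm (Fin k)} (h : ∏ r, row J lam y z r (z (elt I (τ r))) ≠ 0) (r : Fin k) :
    elt I (τ r) ≤ elt J r :=
  not_lt.1 fun hlt => Finset.prod_ne_zero_iff.1 h r (Finset.mem_univ r)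
    (rowProd_eq_zero_of_lt hlt lam y z _)

lemma sum_le_sum_of_elt_le {I J : Subsets n k} {τ : Equiv.Perm (Fin k)}
    (h : ∀ r, elt I (τ r) ≤ elt J r) : ∑ j ∈ I.1, (j : ℕ) ≤ ∑ j ∈ J.1, (j : ℕ) := by
  rw [← sum_elt J, ← sum_elt I, ← Equiv.sum_comp τ fun r => (elt I r : ℕ)]
  exact Finset.sum_le_sum fun r _ => h r

lemma elt_comp_eq_of_elt_le {I J : Subsets n k} {τ : Equiv.Perm (Fin k)}
    (h : ∀ r, elt I (τ r) ≤ elt J r) (hsum : ∑ j ∈ J.1, (j : ℕ) ≤ ∑ j ∈ I.1, (j : ℕ)) (r : Fin k) :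
    elt I (τ r) = elt J r := by
  have heq := (sum_le_sum_of_elt_le h).antisymm hsum
  rw [← sum_elt J, ← sum_elt I, ← Equiv.sum_comp τ fun r => (elt I r : ℕ),
    Finset.sum_eq_sum_iff_of_le fun r _ => Fin.le_def.1 (h r)] at heq
  exact Fin.ext (heq r (Finset.mem_univ r))

lemma sum_lt_sum_of_W_ne_zero {I J : Subsets n k} (hIJ : I ≠ J) {lam y : K} {z : Fin n → K}
    (h : W J lam (z ∘ elt I) z y ≠ 0) : ∑ j ∈ I.1, (j : ℕ) < ∑ j ∈ J.1, (j : ℕ) := by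
  rw [W_eq_symSum, symSum_apply] at h
  obtain ⟨τ, -, hτ⟩ := Finset.exists_ne_zero_of_sum_ne_zero (right_ne_zero_of_mul h)
  have hle := elt_le_of_prod_row_ne_zero (left_ne_zero_of_mul hτ)
  refine (sum_le_sum_of_elt_le hle).lt_of_not_ge fun hsum => hIJ ?_
  have hsub : J.1 ⊆ I.1 := fun j hj => by
    obtain ⟨r, rfl⟩ := exists_elt_eq hj
    exact elt_comp_eq_of_elt_le hle hsum r ▸ elt_mem I (τ r)
  exact Subtype.ext (Finset.eq_of_subset_of_card_le hsub (by rw [I.2, J.2])).symm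

lemma W_elt_self_ne_zero (I : Subsets n k) {lam y : K} {z : Fin n → K}
    (hy : y ≠ 0) (hz : Function.Injective z) (hzy : ∀ i j, z i - z j + y ≠ 0)
    (hlam : ∀ c : ℤ, lam + c * y ≠ 0) : W I lam (z ∘ elt I) z y ≠ 0 := by
  have hid (τ : Equiv.Perm (Fin k)) (hτ : ∏ r, row I lam y z r (z (elt I (τ r))) ≠ 0) : τ = 1 :=
    Equiv.ext fun r => elt_injective I
      (elt_comp_eq_of_elt_le (elt_le_of_prod_row_ne_zero hτ) le_rfl r)
  have hrow (r : Fin k) : row I lam y z r (z (elt I r)) ≠ 0 := by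
    simp only [row, rowProd, Finset.prod_ne_zero_iff]
    intro q _
    split_ifs with hlt heq
    · exact hzy _ _
    · rw [heq, add_sub_cancel_right, sub_eq_add_neg, ← neg_mul]
      exact_mod_cast hlam (-wt (elt I r) I)
    · exact sub_ne_zero.2 (hz.ne (Ne.symm heq))
  have hpair : pairProd y (z ∘ elt I) ≠ 0 := by
    simp only [pairProd, Finset.prod_ne_zero_iff]
    exact fun r _ s hs => div_ne_zero (hzy _ _)
      (sub_ne_zero.2 ((hz.comp (elt_injective I)).ne (Finset.mem_Ioi.1 hs).ne))
  rw [W_eq_symSum, symSum_apply, Finset.sum_eq_single 1]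
  · exact mul_ne_zero (pow_ne_zero _ hy)
      (mul_ne_zero (Finset.prod_ne_zero_iff.2 fun r _ => hrow r) hpair)
  · exact fun τ _ hτ => mul_eq_zero_of_left (not_not.1 (mt (hid τ) hτ)) _
  · exact fun h => absurd (Finset.mem_univ _) h

end WeightFunctions

/-! ### Modified weight functions -/

section Reversal

variable {n k : ℕ} {a b : Fin n}

/-- The image of a subset under the longest permutation. -/
def revSubset (J : Subsets n k) : Subsets n k := permSubset Fin.revPerm⁻¹ J

lemma mem_revSubset (J : Subsets n k) (j : Fin n) : j ∈ (revSubset J).1 ↔ j.rev ∈ J.1 :=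
  mem_permSubset _ _ _

lemma word_revSubset (J : Subsets n k) : word (revSubset J).1 = word J.1 ∘ Fin.rev := by
  ext j
  simp only [word, mem_revSubset, Function.comp_apply]

lemma revSubset_injective : Function.Injective (revSubset (n := n) (k := k)) := fun I J h => by
  ext j
  rw [← Fin.rev_rev j, ← mem_revSubset, h, mem_revSubset]

lemma rev_covBy_rev (hab : a ⋖ b) : b.rev ⋖ a.rev :=
  (apply_covBy_apply_iff Fin.revOrderIso).2 hab.toDual

lemma swap_rev (a b j : Fin n) : Equiv.swap b.rev a.rev j.rev = (Equiv.swap a b j).rev := by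
  rw [Equiv.swap_comm, Fin.rev_injective.swap_apply]

lemma comp_swap_comp_rev {α : Type*} (z : Fin n → α) (a b : Fin n) :
    (z ∘ Equiv.swap a b) ∘ Fin.rev = (z ∘ Fin.rev) ∘ Equiv.swap b.rev a.rev := by
  ext j
  rw [← Fin.rev_rev j, Function.comp_apply, Function.comp_apply, Function.comp_apply,
    Function.comp_apply, swap_rev, Fin.rev_rev, Fin.rev_rev]

lemma revSubset_permSubset_swap (a b : Fin n) (J : Subsets n k) :
    revSubset (permSubset (Equiv.swap a b) J) =
      permSubset (Equiv.swap b.rev a.rev) (revSubset J) := by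
  ext j
  rw [← Fin.rev_rev j, mem_permSubset, Equiv.swap_inv, swap_rev, mem_revSubset, mem_revSubset,
    mem_permSubset, Equiv.swap_inv, Fin.rev_rev, Fin.rev_rev]

lemma wt_rev (hab : a ⋖ b) (J : Subsets n k) (h : hwt (word J.1 a) + hwt (word J.1 b) = 0) :
    wt a.rev (revSubset J) = 2 * k - n - wt b J := by
  have hleft : wt a.rev (revSubset J) = ∑ j ∈ Finset.Iio a, hwt (word J.1 j) := by
    rw [wt_eq_sum, word_revSubset]
    exact Finset.sum_equiv Fin.revPerm (by simp [Fin.rev_lt_iff]) fun _ _ => rfl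
  have htotal : ∑ j ∈ Finset.Iio a, hwt (word J.1 j) + (hwt (word J.1 a) + wt a J) =
      ∑ j, hwt (word J.1 j) := by
    rw [Fintype.sum_eq_add_sum_compl a, wt_eq_sum, ← Finset.Ioi_disjUnion_Iio,
      Finset.sum_disjUnion]
    ring
  rw [sum_hwt_word, wt_eq_of_covBy hab, ← hleft] at htotal
  linarith

end Reversal

section ModifiedWeight

variable {K : Type*} [Field K] {n k : ℕ} {a b : Fin n}

lemma eK_comp_perm (t : Fin k → K) (y : K) (π : Equiv.Perm (Fin k)) : eK (t ∘ π) y = eK t y :=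
  (Finset.prod_congr rfl fun r _ => Equiv.prod_comp π fun s => t (π r) - t s + y).trans
    (Equiv.prod_comp π fun r => ∏ s, (t r - t s + y))

lemma WMinus_eq (J : Subsets n k) (lam : K) (t : Fin k → K) (z : Fin n → K) (y : K) :
    WMinus J lam t z y = (-1) ^ k / eK t y *
      W (revSubset J) (-lam - ((n : K) - 2 * (k : K)) * y) t (z ∘ Fin.rev) y :=
  rfl

lemma WMinus_comp_perm (J : Subsets n k) (lam : K) (t : Fin k → K) (z : Fin n → K) (y : K)
    (π : Equiv.Perm (Fin k)) : WMinus J lam (t ∘ π) z y = WMinus J lam t z y := by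
  rw [WMinus_eq, WMinus_eq, eK_comp_perm, W_comp_perm]

lemma WMinus_comp_swap (hab : a ⋖ b) {J : Subsets n k} (h : a ∈ J.1 ↔ b ∈ J.1)
    (lam : K) (t : Fin k → K) (z : Fin n → K) (y : K) :
    WMinus J lam t (z ∘ Equiv.swap a b) y = WMinus J lam t z y := by
  have hrev (j : Fin n) : j.rev ∈ (revSubset J).1 ↔ j ∈ J.1 := by rw [mem_revSubset, Fin.rev_rev]
  rw [WMinus_eq, WMinus_eq, comp_swap_comp_rev]
  congr 1
  by_cases ha : a ∈ J.1
  · exact W_comp_swap_of_mem (rev_covBy_rev hab) ((hrev b).2 (h.1 ha)) ((hrev a).2 ha) _ _ _ _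
  · exact W_comp_swap_of_notMem (rev_covBy_rev hab) (mt (hrev b).1 (mt h.2 ha))
      (mt (hrev a).1 ha) _ _ _ _

lemma exists_linearMap_WMinus (hab : a ⋖ b) {J : Subsets n k} (ha : a ∉ J.1) (hb : b ∈ J.1)
    (lam : K) (t : Fin k → K) (y : K) {m : K} (hm : m = -(lam - y * (wt b J : K)))
    (z : Fin n → K) : ∃ Φ : (K → K) →ₗ[K] K,
      WMinus J lam t z y = Φ (leftFactor m y (z b) (z a)) ∧
      WMinus J lam t (z ∘ Equiv.swap a b) y = Φ (leftFactor m y (z a) (z b)) ∧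
      WMinus (permSubset (Equiv.swap a b) J) lam t z y = Φ (rightFactor m y (z b) (z a)) ∧
      WMinus (permSubset (Equiv.swap a b) J) lam t (z ∘ Equiv.swap a b) y =
        Φ (rightFactor m y (z a) (z b)) := by
  have hrev (j : Fin n) : j.rev ∈ (revSubset J).1 ↔ j ∈ J.1 := by rw [mem_revSubset, Fin.rev_rev]
  obtain ⟨r, hr⟩ := exists_elt_eq ((hrev b).2 hb)
  have hcov := rev_covBy_rev hab
  have ha' := mt (hrev a).1 ha
  have hwt : wt a.rev (revSubset J) = 2 * k - n - wt b J :=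
    wt_rev hab J (by rw [word, if_neg ha, word, if_pos hb]; rfl)
  have hm' : -lam - ((n : K) - 2 * (k : K)) * y - (wt a.rev (revSubset J) : K) * y = m := by
    rw [hm, hwt]
    push_cast
    ring
  refine ⟨((-1) ^ k / eK t y) • exchangeForm (revSubset J) r b.rev a.rev
    (-lam - ((n : K) - 2 * (k : K)) * y) t (z ∘ Fin.rev) y, ?_⟩
  simp only [WMinus_eq, comp_swap_comp_rev, revSubset_permSubset_swap,
    W_eq_exchangeForm hcov hr ha', W_permSubset_swap_eq_exchangeForm hcov hr ha',
    exchangeForm_comp_swap hcov hr ha', hm', LinearMap.smul_apply, smul_eq_mul,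
    Function.comp_apply, Equiv.swap_apply_left, Equiv.swap_apply_right, Fin.rev_rev, and_self]

lemma WMinus_eq_dynR_of_mem_right (hab : a ⋖ b) {J : Subsets n k} (ha : a ∉ J.1) (hb : b ∈ J.1)
    (lam : K) (t : Fin k → K) (z : Fin n → K) (y : K) {m : K} (hm : m = lam - y * (wt b J : K))
    (hm0 : m ≠ 0) (hz : z a - z b - y ≠ 0) :
    WMinus J lam t z y =
      dynR m (z a - z b) y (1, 0) (1, 0) *
          WMinus (permSubset (Equiv.swap a b) J) lam t (z ∘ Equiv.swap a b) y +
        dynR m (z a - z b) y (1, 0) (0, 1) * WMinus J lam t (z ∘ Equiv.swap a b) y := by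
  obtain ⟨Φ, h₁, h₂, -, h₄⟩ := exists_linearMap_WMinus hab ha hb lam t y (congrArg Neg.neg hm) z
  rw [h₁, h₂, h₄]
  simp only [← smul_eq_mul, ← map_smul, ← map_add]
  congr 1
  ext x
  simp only [Pi.add_apply, Pi.smul_apply, smul_eq_mul, leftFactor, rightFactor]
  change _ = (m - y) * (z a - z b) / (m * (z a - z b - y)) * _ +
    -((m - (z a - z b)) * y) / (m * (z a - z b - y)) * _
  field_simp
  ring

lemma WMinus_eq_dynR_of_mem_left (hab : a ⋖ b) {J : Subsets n k} (ha : a ∈ J.1) (hb : b ∉ J.1)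
    (lam : K) (t : Fin k → K) (z : Fin n → K) (y : K) {m : K} (hm : m = lam - y * (wt b J : K))
    (hm0 : m ≠ 0) (hz : z a - z b - y ≠ 0) :
    WMinus J lam t z y =
      dynR m (z a - z b) y (0, 1) (0, 1) *
          WMinus (permSubset (Equiv.swap a b) J) lam t (z ∘ Equiv.swap a b) y +
        dynR m (z a - z b) y (0, 1) (1, 0) * WMinus J lam t (z ∘ Equiv.swap a b) y := by
  have ha' : a ∉ (permSubset (Equiv.swap a b) J).1 := by
    rwa [mem_permSubset, Equiv.swap_inv, Equiv.swap_apply_left]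
  have hb' : b ∈ (permSubset (Equiv.swap a b) J).1 := by
    rwa [mem_permSubset, Equiv.swap_inv, Equiv.swap_apply_right]
  rw [← wt_permSubset_swap hab hab.lt.ne' J] at hm
  obtain ⟨Φ, -, h₂, h₃, h₄⟩ :=
    exists_linearMap_WMinus hab ha' hb' lam t y (congrArg Neg.neg hm) z
  rw [permSubset_swap_swap] at h₃ h₄
  rw [h₂, h₃, h₄]
  simp only [← smul_eq_mul, ← map_smul, ← map_add]
  congr 1
  ext x
  simp only [Pi.add_apply, Pi.smul_apply, smul_eq_mul, leftFactor, rightFactor]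
  change _ = (m + y) * (z a - z b) / (m * (z a - z b - y)) * _ +
    -((m + (z a - z b)) * y) / (m * (z a - z b - y)) * _
  field_simp
  ring

lemma WMinus_eq_dynR (hab : a ⋖ b) {J : Subsets n k} (h : ¬(a ∈ J.1 ↔ b ∈ J.1))
    (lam : K) (t : Fin k → K) (z : Fin n → K) (y : K)
    (hm : lam - y * (wt b J : K) ≠ 0) (hz : z a - z b - y ≠ 0) :
    WMinus J lam t z y =
      dynR (lam - y * (wt b J : K)) (z a - z b) y (word J.1 a, word J.1 b)
            (word J.1 a, word J.1 b) *
          WMinus (permSubset (Equiv.swap a b) J) lam t (z ∘ Equiv.swap a b) y +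
        dynR (lam - y * (wt b J : K)) (z a - z b) y (word J.1 a, word J.1 b)
            (word J.1 b, word J.1 a) * WMinus J lam t (z ∘ Equiv.swap a b) y := by
  by_cases hb : b ∈ J.1
  · have ha : a ∉ J.1 := fun ha => h (iff_of_true ha hb)
    simp only [word, if_pos hb, if_neg ha]
    exact WMinus_eq_dynR_of_mem_right hab ha hb lam t z y rfl hm hz
  · have ha : a ∈ J.1 := by_contra fun ha => h (iff_of_false ha hb)
    simp only [word, if_neg hb, if_pos ha]
    exact WMinus_eq_dynR_of_mem_left hab ha hb lam t z y rfl hm hz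

lemma WMinus_elt_eq (I J : Subsets n k) (lam : K) (z : Fin n → K) (y : K) :
    WMinus J lam (z ∘ elt I) z y = (-1) ^ k / eK (z ∘ elt I) y *
      W (revSubset J) (-lam - ((n : K) - 2 * (k : K)) * y)
        ((z ∘ Fin.rev) ∘ elt (revSubset I)) (z ∘ Fin.rev) y := by
  obtain ⟨π, hπ⟩ := exists_comp_elt_eq Fin.revPerm⁻¹ I
  have hz : z ∘ elt I = ((z ∘ Fin.rev) ∘ elt (revSubset I)) ∘ π := by
    rw [Function.comp_assoc, revSubset, ← hπ]
    exact funext fun r => congrArg z (Fin.rev_rev _).symm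
  rw [WMinus_eq, ← W_comp_perm _ _ ((z ∘ Fin.rev) ∘ _) _ _ π, ← hz]

lemma sum_lt_sum_of_WMinus_ne_zero {I J : Subsets n k} (hIJ : I ≠ J) {lam y : K} {z : Fin n → K}
    (h : WMinus J lam (z ∘ elt I) z y ≠ 0) :
    ∑ j ∈ (revSubset I).1, (j : ℕ) < ∑ j ∈ (revSubset J).1, (j : ℕ) := by
  rw [WMinus_elt_eq] at h
  exact sum_lt_sum_of_W_ne_zero (revSubset_injective.ne hIJ) (right_ne_zero_of_mul h)

lemma WMinus_elt_self_ne_zero (I : Subsets n k) {lam y : K} {z : Fin n → K}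
    (hy : y ≠ 0) (hz : Function.Injective z) (hzy : ∀ i j, z i - z j + y ≠ 0)
    (hlam : ∀ c : ℤ, lam + c * y ≠ 0) : WMinus I lam (z ∘ elt I) z y ≠ 0 := by
  have heK : eK (z ∘ elt I) y ≠ 0 :=
    Finset.prod_ne_zero_iff.2 fun r _ => Finset.prod_ne_zero_iff.2 fun s _ => hzy _ _
  have hlam' (c : ℤ) : -lam - ((n : K) - 2 * (k : K)) * y + c * y ≠ 0 := fun h =>
    hlam (n - 2 * k - c) (by push_cast; linear_combination -h)
  rw [WMinus_elt_eq]
  exact mul_ne_zero (div_ne_zero (pow_ne_zero _ (neg_ne_zero.2 one_ne_zero)) heK)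
    (W_elt_self_ne_zero _ hy (hz.comp Fin.rev_injective) (fun _ _ => hzy _ _) hlam')

lemma Q_permSubset (σ : Equiv.Perm (Fin n)) (I : Subsets n k) (z : Fin n → K) (y : K) :
    Q (permSubset σ I) z y = Q I (z ∘ σ) y := by
  have hcompl : (permSubset σ I).1ᶜ = I.1ᶜ.map σ.toEmbedding := by
    ext j
    rw [Finset.mem_compl, mem_permSubset, Finset.mem_map_equiv, Finset.mem_compl]
    rfl
  rw [Q, Q, hcompl]
  simp only [permSubset, Finset.prod_map, Function.comp_apply, Equiv.coe_toEmbedding]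

section Map

variable {K' : Type*} [Field K'] (φ : K →+* K')

lemma map_lFactor (I : Subsets n k) (lam : K) (t : Fin k → K) (z : Fin n → K) (y : K) (r : Fin k)
    (q : Fin n) :
    φ (lFactor I lam t z y r q) = lFactor I (φ lam) (φ ∘ t) (φ ∘ z) (φ y) r q := by
  simp only [lFactor, apply_ite φ, map_add, map_sub, map_mul, map_intCast, Function.comp_apply]

lemma map_W (I : Subsets n k) (lam : K) (t : Fin k → K) (z : Fin n → K) (y : K) :
    φ (W I lam t z y) = W I (φ lam) (φ ∘ t) (φ ∘ z) (φ y) := by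
  simp only [W, map_mul, map_pow, map_sum, map_prod, map_lFactor, map_div₀, map_add, map_sub,
    Function.comp_assoc, Function.comp_apply]

lemma map_WMinus (J : Subsets n k) (lam : K) (t : Fin k → K) (z : Fin n → K) (y : K) :
    φ (WMinus J lam t z y) = WMinus J (φ lam) (φ ∘ t) (φ ∘ z) (φ y) := by
  simp only [WMinus_eq, map_W, eK, map_mul, map_div₀, map_pow, map_neg, map_one, map_prod, map_add,
    map_sub, map_natCast, map_ofNat, Function.comp_assoc, Function.comp_apply]

lemma map_Q (I : Subsets n k) (z : Fin n → K) (y : K) : φ (Q I z y) = Q I (φ ∘ z) (φ y) := by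
  simp only [Q, map_prod, map_add, map_sub, Function.comp_apply]

end Map

end ModifiedWeight

/-! ### Rational functions with permitted denominators -/

section Membership

variable {K σ : Type*} [Field K] [SetLike σ K] [SubringClass σ K] {s : σ} {n k : ℕ}

lemma div_mem_of_inv_mem {x d : K} (hx : x ∈ s) (hd : d⁻¹ ∈ s) : x / d ∈ s :=
  div_eq_mul_inv x d ▸ mul_mem hx hd

lemma inv_neg_mem {d : K} (hd : d⁻¹ ∈ s) : (-d)⁻¹ ∈ s :=
  inv_neg (a := d) ▸ neg_mem hd

lemma inv_prod_mem {ι : Type*} (u : Finset ι) {f : ι → K} (hf : ∀ i ∈ u, (f i)⁻¹ ∈ s) :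
    (∏ i ∈ u, f i)⁻¹ ∈ s :=
  Finset.prod_inv_distrib f (s := u) ▸ prod_mem hf

lemma dynR_mem {lam z y : K} (hlam : lam ∈ s) (hz : z ∈ s) (hy : y ∈ s)
    (hinv : (lam * (z - y))⁻¹ ∈ s) (p q : Fin 2 × Fin 2) : dynR lam z y p q ∈ s := by
  have hdiag {x : K} (hx : x ∈ s) : x * z / (lam * (z - y)) ∈ s :=
    div_mem_of_inv_mem (mul_mem hx hz) hinv
  have hoff {x : K} (hx : x ∈ s) : -(x * y) / (lam * (z - y)) ∈ s :=
    div_mem_of_inv_mem (neg_mem (mul_mem hx hy)) hinv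
  rw [dynR, Matrix.submatrix_apply]
  generalize finProdFinEquiv p = i
  generalize finProdFinEquiv q = j
  fin_cases i <;> fin_cases j <;>
    first
    | exact zero_mem s
    | exact one_mem s
    | exact hdiag (add_mem hlam hy)
    | exact hdiag (sub_mem hlam hy)
    | exact hoff (add_mem hlam hz)
    | exact hoff (sub_mem hlam hz)

lemma lFactor_mem (I : Subsets n k) {lam y : K} {t : Fin k → K} {z : Fin n → K}
    (hlam : lam ∈ s) (hy : y ∈ s) (ht : ∀ r, t r ∈ s) (hz : ∀ i, z i ∈ s) (r : Fin k)
    (a : Fin n) : lFactor I lam t z y r a ∈ s := by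
  unfold lFactor
  split_ifs
  · exact add_mem (sub_mem (ht _) (hz _)) hy
  · exact sub_mem (sub_mem (add_mem hlam (ht _)) (hz _)) (mul_mem (intCast_mem _ _) hy)
  · exact sub_mem (ht _) (hz _)

lemma W_mem (I : Subsets n k) {lam y : K} {t : Fin k → K} {z : Fin n → K}
    (hlam : lam ∈ s) (hy : y ∈ s) (ht : ∀ r, t r ∈ s) (hz : ∀ i, z i ∈ s)
    (hinv : Pairwise fun r r' => (t r - t r')⁻¹ ∈ s) : W I lam t z y ∈ s := by
  refine mul_mem (pow_mem hy _) (sum_mem fun τ _ => mul_mem ?_ ?_)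
  · exact prod_mem fun r _ => prod_mem fun a _ => lFactor_mem I hlam hy (fun _ => ht _) hz r a
  · exact prod_mem fun r _ => prod_mem fun r' hr' => div_mem_of_inv_mem
      (add_mem (sub_mem (ht _) (ht _)) hy) (hinv (τ.injective.ne (Finset.mem_Ioi.1 hr').ne))

lemma WMinus_mem (J : Subsets n k) {lam y : K} {t : Fin k → K} {z : Fin n → K}
    (hlam : lam ∈ s) (hy : y ∈ s) (ht : ∀ r, t r ∈ s) (hz : ∀ i, z i ∈ s)
    (hinv : Pairwise fun r r' => (t r - t r')⁻¹ ∈ s) (hinv' : ∀ r r', (t r - t r' + y)⁻¹ ∈ s) :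
    WMinus J lam t z y ∈ s := by
  have hshift : -lam - ((n : K) - 2 * (k : K)) * y ∈ s :=
    sub_mem (neg_mem hlam) (mul_mem (sub_mem (natCast_mem _ _)
      (mul_mem (ofNat_mem _ 2) (natCast_mem _ _))) hy)
  refine mul_mem (div_mem_of_inv_mem (pow_mem (neg_mem (one_mem _)) _) ?_)
    (W_mem _ hshift hy ht (fun _ => hz _) hinv)
  exact inv_prod_mem _ fun r _ => inv_prod_mem _ fun r' _ => hinv' r r'

lemma inv_Q_mem (I : Subsets n k) {z : Fin n → K} {y : K}
    (hinv : ∀ i j, (z i - z j + y)⁻¹ ∈ s) : (Q I z y)⁻¹ ∈ s :=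
  inv_prod_mem _ fun i _ => inv_prod_mem _ fun j _ => hinv i j

end Membership

section RationalFunctions

variable {n : ℕ}

/-- The permitted denominators, as rational functions. -/
def denomsF (n : ℕ) : Submonoid (F n) := (denoms n).map (algebraMap _ (F n))

lemma ne_zero_of_mem_denomsF {d : F n} (hd : d ∈ denomsF n) : d ≠ 0 := by
  obtain ⟨q, hq, rfl⟩ := hd
  exact IsFractionRing.to_map_ne_zero_of_mem_nonZeroDivisors (denoms_le n hq)

lemma mem_L_iff {x : F n} :
    x ∈ L n ↔ ∃ p : MvPolynomial (Var n) ℂ, ∃ d ∈ denomsF n, x = algebraMap _ (F n) p * d⁻¹ := by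
  constructor
  · rintro ⟨p, q, hq, h⟩
    exact ⟨p, _, Submonoid.mem_map_of_mem _ hq, h⟩
  · rintro ⟨p, _, ⟨q, hq, rfl⟩, h⟩
    exact ⟨p, q, hq, h⟩

lemma algebraMap_mem_L (p : MvPolynomial (Var n) ℂ) : algebraMap _ (F n) p ∈ L n :=
  mem_L_iff.2 ⟨p, 1, one_mem _, by rw [inv_one, mul_one]⟩

lemma inv_mem_L {d : F n} (hd : d ∈ denomsF n) : d⁻¹ ∈ L n :=
  mem_L_iff.2 ⟨1, d, hd, by rw [map_one, one_mul]⟩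

lemma lamF_mem_L : lamF n ∈ L n := algebraMap_mem_L _

lemma yF_mem_L : yF n ∈ L n := algebraMap_mem_L _

lemma zF_mem_L (i : Fin n) : zF n i ∈ L n := algebraMap_mem_L _

lemma lamF_add_mem_denomsF (l : ℤ) : lamF n + l * yF n ∈ denomsF n :=
  ⟨_, Submonoid.subset_closure (Or.inl (Or.inl ⟨l, rfl⟩)),
    by rw [map_add, map_mul, map_intCast]; rfl⟩

lemma zF_sub_mem_denomsF {i j : Fin n} (hij : i ≠ j) : zF n i - zF n j ∈ denomsF n :=
  ⟨_, Submonoid.subset_closure (Or.inl (Or.inr ⟨i, j, hij, rfl⟩)), map_sub _ _ _⟩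

lemma zF_sub_sub_mem_denomsF (i j : Fin n) : zF n i - zF n j - yF n ∈ denomsF n :=
  ⟨_, Submonoid.subset_closure (Or.inr ⟨i, j, rfl⟩), by rw [map_sub, map_sub]; rfl⟩

lemma zF_injective : Function.Injective (zF n) := fun _ _ h =>
  by_contra fun hij => ne_zero_of_mem_denomsF (zF_sub_mem_denomsF hij) (sub_eq_zero.2 h)

lemma yF_ne_zero : yF n ≠ 0 :=
  (map_ne_zero_iff _ (IsFractionRing.injective _ _)).2 (MvPolynomial.X_ne_zero _)

lemma zF_sub_add_eq_neg (i j : Fin n) : zF n i - zF n j + yF n = -(zF n j - zF n i - yF n) := by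
  ring

lemma zF_sub_add_ne_zero (i j : Fin n) : zF n i - zF n j + yF n ≠ 0 :=
  zF_sub_add_eq_neg i j ▸
    neg_ne_zero.2 (ne_zero_of_mem_denomsF (zF_sub_sub_mem_denomsF j i))

lemma inv_zF_sub_add_mem_L (i j : Fin n) : (zF n i - zF n j + yF n)⁻¹ ∈ L n :=
  zF_sub_add_eq_neg i j ▸ inv_neg_mem (inv_mem_L (zF_sub_sub_mem_denomsF j i))

lemma dynR_mem_L (c : ℤ) (i j : Fin n) (p q : Fin 2 × Fin 2) :
    dynR (lamF n - yF n * c) (zF n i - zF n j) (yF n) p q ∈ L n := by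
  have hlam : lamF n - yF n * c ∈ denomsF n := by
    have h := lamF_add_mem_denomsF (n := n) (-c)
    rwa [Int.cast_neg, neg_mul, mul_comm, ← sub_eq_add_neg] at h
  exact dynR_mem (sub_mem lamF_mem_L (mul_mem yF_mem_L (intCast_mem _ _)))
    (sub_mem (zF_mem_L i) (zF_mem_L j)) yF_mem_L
    (inv_mem_L (mul_mem hlam (zF_sub_sub_mem_denomsF i j))) p q

lemma WMinus_mem_L {k : ℕ} (I J : Subsets n k) :
    WMinus J (lamF n) (zF n ∘ elt I) (zF n) (yF n) ∈ L n :=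
  WMinus_mem J lamF_mem_L yF_mem_L (fun _ => zF_mem_L _) zF_mem_L
    (fun _ _ h => inv_mem_L (zF_sub_mem_denomsF ((elt_injective I).ne h)))
    fun _ _ => inv_zF_sub_add_mem_L _ _

lemma inv_Q_mem_L {k : ℕ} (I : Subsets n k) : (Q I (zF n) (yF n))⁻¹ ∈ L n :=
  inv_Q_mem I inv_zF_sub_add_mem_L

lemma Q_ne_zero {k : ℕ} (I : Subsets n k) : Q I (zF n) (yF n) ≠ 0 :=
  Finset.prod_ne_zero_iff.2 fun _ _ => Finset.prod_ne_zero_iff.2 fun _ _ => zF_sub_add_ne_zero _ _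

lemma substZ_algebraMap (σ : Equiv.Perm (Fin n)) (p : MvPolynomial (Var n) ℂ) :
    substZ σ (algebraMap _ (F n) p) = algebraMap _ (F n) (MvPolynomial.rename (permVar σ) p) :=
  IsFractionRing.algEquivOfAlgEquiv_algebraMap _ _

lemma substZ_X (σ : Equiv.Perm (Fin n)) (v : Var n) : substZ σ (X v) = X (permVar σ v) := by
  rw [X, substZ_algebraMap, MvPolynomial.rename_X]
  rfl

lemma substZ_lamF (σ : Equiv.Perm (Fin n)) : substZ σ (lamF n) = lamF n := substZ_X σ _

lemma substZ_yF (σ : Equiv.Perm (Fin n)) : substZ σ (yF n) = yF n := substZ_X σ _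

lemma substZ_zF (σ : Equiv.Perm (Fin n)) (i : Fin n) : substZ σ (zF n i) = zF n (σ i) :=
  substZ_X σ _

lemma substZ_mul (σ τ : Equiv.Perm (Fin n)) (x : F n) :
    substZ (σ * τ) x = substZ σ (substZ τ x) := by
  obtain ⟨p, q, -, rfl⟩ := IsFractionRing.div_surjective (MvPolynomial (Var n) ℂ) x
  have hcomp : (permVar (σ * τ) : Var n → Var n) = permVar σ ∘ permVar τ := by
    ext (_ | _ | _) <;> rfl
  simp only [map_div₀, substZ_algebraMap, MvPolynomial.rename_rename, hcomp]

lemma substZ_one (x : F n) : substZ 1 x = x := by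
  obtain ⟨p, q, -, rfl⟩ := IsFractionRing.div_surjective (MvPolynomial (Var n) ℂ) x
  have hid : (permVar (1 : Equiv.Perm (Fin n)) : Var n → Var n) = id := by
    ext (_ | _ | _) <;> rfl
  simp only [map_div₀, substZ_algebraMap, hid, MvPolynomial.rename_id_apply]

lemma substZ_mem_denomsF (σ : Equiv.Perm (Fin n)) {d : F n} (hd : d ∈ denomsF n) :
    substZ σ d ∈ denomsF n := by
  have hle : denomsF n ≤ (denomsF n).comap (substZ σ) := by
    rw [denomsF, Submonoid.map_le_iff_le_comap, denoms, Submonoid.closure_le]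
    rintro p ((⟨l, rfl⟩ | ⟨i, j, hij, rfl⟩) | ⟨i, j, rfl⟩) <;>
      simp only [SetLike.mem_coe, Submonoid.mem_comap, substZ_algebraMap, map_add, map_sub,
        map_mul, map_intCast, MvPolynomial.rename_X]
    · exact lamF_add_mem_denomsF l
    · exact zF_sub_mem_denomsF (σ.injective.ne hij)
    · exact zF_sub_sub_mem_denomsF (σ i) (σ j)
  exact hle hd

lemma substZ_mem_L (σ : Equiv.Perm (Fin n)) {x : F n} (hx : x ∈ L n) : substZ σ x ∈ L n := by
  obtain ⟨p, d, hd, rfl⟩ := mem_L_iff.1 hx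
  exact mem_L_iff.2 ⟨_, _, substZ_mem_denomsF σ hd, by rw [map_mul, map_inv₀, substZ_algebraMap]⟩

end RationalFunctions

/-! ### The operators in coordinates -/

section Coordinates

variable {n : ℕ} {a b : Fin n}

lemma repr_tmul (f : F n) (c : C2pow n) (w : Fin n → Fin 2) :
    (vBasis n).repr (f ⊗ₜ[ℂ] c) w = f * algebraMap ℂ (F n)
      ((Basis.piTensorProduct fun _ : Fin n => Pi.basisFun ℂ (Fin 2)).repr c w) := by
  rw [vBasis, Algebra.TensorProduct.basis_repr_tmul]
  rfl

lemma smul_vBasis (f : F n) (w : Fin n → Fin 2) :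
    f • vBasis n w = f ⊗ₜ[ℂ] (⨂ₜ[ℂ] j, (Pi.single (w j) 1 : Fin 2 → ℂ)) := by
  rw [vBasis_apply, TensorProduct.smul_tmul', smul_eq_mul, mul_one]

lemma repr_smul_vBasis (f : F n) (u w : Fin n → Fin 2) :
    (vBasis n).repr (f • vBasis n u) w = if u = w then f else 0 := by
  rw [map_smul, Module.Basis.repr_self, Finsupp.smul_single, smul_eq_mul, mul_one,
    Finsupp.single_apply]

lemma vBasis_induction {P : V n → Prop} (zero : P 0) (add : ∀ u v, P u → P v → P (u + v))
    (smul : ∀ (f : F n) w, P (f • vBasis n w)) (v : V n) : P v := by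
  rw [← (vBasis n).sum_repr v]
  exact Finset.sum_induction _ P add zero fun w _ => smul _ w

lemma mem_lattice_iff {v : V n} : v ∈ lattice n ↔ ∀ w, (vBasis n).repr v w ∈ L n := by
  constructor
  · rintro ⟨u, rfl⟩ w
    induction u with
    | zero =>
      rw [map_zero, map_zero]
      exact zero_mem _
    | tmul f c =>
      rw [LinearMap.rTensor_tmul, repr_tmul]
      exact mul_mem f.2 (Subalgebra.algebraMap_mem _ _)
    | add u v hu hv =>
      rw [map_add, map_add]
      exact add_mem hu hv
  · intro h
    rw [← (vBasis n).sum_repr v]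
    refine sum_mem fun w _ => ?_
    rw [smul_vBasis]
    exact ⟨(⟨_, h w⟩ : L n) ⊗ₜ _, rfl⟩

lemma repr_substV (σ : Equiv.Perm (Fin n)) (v : V n) (w : Fin n → Fin 2) :
    (vBasis n).repr (substV σ v) w = substZ σ ((vBasis n).repr v w) := by
  induction v using TensorProduct.induction_on with
  | zero => simp only [map_zero, Finsupp.zero_apply]
  | tmul f c =>
    rw [repr_tmul, map_mul, AlgEquiv.commutes]
    exact repr_tmul _ _ _
  | add u v hu hv => simp only [map_add, Finsupp.add_apply, hu, hv]

lemma permFactors_smul_vBasis (σ : Equiv.Perm (Fin n)) (f : F n) (w : Fin n → Fin 2) :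
    permFactors σ (f • vBasis n w) = f • vBasis n (w ∘ σ.symm) := by
  rw [smul_vBasis, smul_vBasis, permFactors, LinearMap.lTensor_tmul]
  congr 1
  exact PiTensorProduct.reindex_tprod _ _

lemma repr_permFactors (σ : Equiv.Perm (Fin n)) (v : V n) (w : Fin n → Fin 2) :
    (vBasis n).repr (permFactors σ v) w = (vBasis n).repr v (w ∘ σ) := by
  induction v using vBasis_induction with
  | zero => simp only [map_zero, Finsupp.zero_apply]
  | add u v hu hv => simp only [map_add, Finsupp.add_apply, hu, hv]
  | smul f u =>
    simp only [permFactors_smul_vBasis, repr_smul_vBasis, Equiv.comp_symm_eq]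

lemma update_update_eq_iff {α β : Type*} [DecidableEq α] {a b : α} (hab : a ≠ b) (u w : α → β)
    (p : β × β) : Function.update (Function.update u a p.1) b p.2 = w ↔
      p = (w a, w b) ∧ ∀ j, j ≠ a → j ≠ b → u j = w j := by
  simp only [Function.update_eq_iff, Prod.ext_iff]
  grind

lemma sum_mul_ite_update_update {R α β : Type*} [NonAssocSemiring R] [DecidableEq α]
    [Fintype β] [DecidableEq β] [Fintype α] {a b : α} (hab : a ≠ b) (g : β × β → R) (u w : α → β) :
    ∑ p, g p * (if Function.update (Function.update u a p.1) b p.2 = w then 1 else 0) =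
      if ∀ j, j ≠ a → j ≠ b → u j = w j then g (w a, w b) else 0 := by
  simp only [update_update_eq_iff hab, ite_and, mul_ite, mul_one, mul_zero, Finset.sum_ite_eq',
    Finset.mem_univ, if_true]

lemma repr_RAt (hab : a ≠ b) {S : Finset (Fin n)} (ha : a ∉ S) (hb : b ∉ S) (x : F n) (v : V n)
    (w : Fin n → Fin 2) :
    (vBasis n).repr (RAt a b S x v) w =
      ∑ p, dynR (lamF n - yF n * ∑ m ∈ S, (hwt (w m) : F n)) x (yF n) (w a, w b) p *
        (vBasis n).repr v (Function.update (Function.update w a p.1) b p.2) := by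
  induction v using vBasis_induction with
  | zero => simp only [map_zero, Finsupp.zero_apply, mul_zero, Finset.sum_const_zero]
  | add u v hu hv =>
    simp only [map_add, Finsupp.add_apply, hu, hv, mul_add, Finset.sum_add_distrib]
  | smul f u =>
    simp only [map_smul, RAt, Module.Basis.constr_basis, map_sum, Finsupp.smul_apply,
      Finsupp.finsetSum_apply, Module.Basis.repr_self, smul_eq_mul]
    simp only [Finsupp.single_apply, mul_left_comm _ f, ← Finset.mul_sum, eq_comm (a := u)]
    rw [sum_mul_ite_update_update hab, sum_mul_ite_update_update hab]
    simp only [eq_comm (a := w _)]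
    split_ifs with huw
    · rw [Finset.sum_congr rfl fun m hm => by
        rw [huw m (ne_of_mem_of_not_mem hm ha) (ne_of_mem_of_not_mem hm hb)]]
    · rfl

lemma sum_dynR_mul {K : Type*} [Field K] (l x y : K) (i j : Fin 2) (g : Fin 2 × Fin 2 → K) :
    ∑ p, dynR l x y (i, j) p * g p = if i = j then g (i, j) else
      dynR l x y (i, j) (i, j) * g (i, j) + dynR l x y (i, j) (j, i) * g (j, i) := by
  fin_cases i <;> fin_cases j <;>
    simp [Fintype.sum_prod_type, dynR, finProdFinEquiv, add_comm]

/-- The operator `s̃_i` attached to the adjacent positions `a = i` and `b = i + 1`. -/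
def exchangeOp (a b : Fin n) : V n →ₗ[ℂ] V n :=
  (RAt a b (Finset.Ioi b) (zF n a - zF n b)).restrictScalars ℂ ∘ₗ
    permFactors (Equiv.swap a b) ∘ₗ substV (Equiv.swap a b)

lemma sTilde_eq_exchangeOp {i : ℕ} (hi : i + 1 < n) :
    sTilde i hi = exchangeOp ⟨i, by omega⟩ ⟨i + 1, hi⟩ := by
  have hIoi : (Finset.univ.filter fun m : Fin n => i + 2 ≤ (m : ℕ)) =
      Finset.Ioi ⟨i + 1, hi⟩ := by
    ext m
    simp only [Finset.mem_filter_univ, Finset.mem_Ioi, Fin.lt_def, Nat.succ_le_iff]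
  rw [sTilde, hIoi]
  rfl

lemma comp_swap_eq_self {α β : Type*} [DecidableEq α] {a b : α} {w : α → β} (h : w a = w b) :
    w ∘ Equiv.swap a b = w := by
  rw [Equiv.comp_swap_eq_update, h, Function.update_eq_self, ← h, Function.update_eq_self]

lemma repr_exchangeOp (hab : a < b) (v : V n) (w : Fin n → Fin 2) {m : F n}
    (hm : m = lamF n - yF n * ((∑ j ∈ Finset.Ioi b, hwt (w j) : ℤ) : F n)) :
    (vBasis n).repr (exchangeOp a b v) w =
      if w a = w b then substZ (Equiv.swap a b) ((vBasis n).repr v w) else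
        dynR m (zF n a - zF n b) (yF n) (w a, w b) (w a, w b) *
            substZ (Equiv.swap a b) ((vBasis n).repr v (w ∘ Equiv.swap a b)) +
          dynR m (zF n a - zF n b) (yF n) (w a, w b) (w b, w a) *
            substZ (Equiv.swap a b) ((vBasis n).repr v w) := by
  have hswap : Function.update (Function.update w a (w b)) b (w a) = w ∘ Equiv.swap a b := by
    rw [Equiv.comp_swap_eq_update, Function.update_comm hab.ne]
  rw [Int.cast_sum] at hm
  rw [exchangeOp, LinearMap.comp_apply, LinearMap.comp_apply, LinearMap.restrictScalars_apply,
    repr_RAt hab.ne (by simp [hab.le]) (by simp), ← hm, sum_dynR_mul, Function.update_eq_self,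
    Function.update_eq_self, hswap]
  simp only [repr_permFactors, repr_substV]
  split_ifs with h
  · rw [comp_swap_eq_self h]
  · rw [Function.comp_assoc, ← Equiv.coe_trans, Equiv.swap_swap, Equiv.coe_refl, Function.comp_id]

lemma exchangeOp_smul (hab : a < b) (f : F n) (v : V n) :
    exchangeOp a b (f • v) = substZ (Equiv.swap a b) f • exchangeOp a b v := by
  refine (vBasis n).ext_elem fun w => ?_
  simp only [map_smul, Finsupp.smul_apply, smul_eq_mul, repr_exchangeOp hab _ w rfl, map_mul]
  split_ifs <;> ring

lemma exchangeOp_mem_lattice (hab : a < b) {v : V n} (hv : v ∈ lattice n) :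
    exchangeOp a b v ∈ lattice n := by
  rw [mem_lattice_iff] at hv ⊢
  intro w
  rw [repr_exchangeOp hab _ w rfl]
  split_ifs
  · exact substZ_mem_L _ (hv _)
  · exact add_mem (mul_mem (dynR_mem_L _ _ _ _ _) (substZ_mem_L _ (hv _)))
      (mul_mem (dynR_mem_L _ _ _ _ _) (substZ_mem_L _ (hv _)))

end Coordinates

/-! ### The vectors `ξ_I` -/

section Xi

variable {n k : ℕ} {a b : Fin n}

/-- The coefficient of `v_J` in `ξ_I`. -/
def xiCoeff (I J : Subsets n k) : F n :=
  (Q I (zF n) (yF n))⁻¹ * WMinus J (lamF n) (zF n ∘ elt I) (zF n) (yF n)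

lemma xi_eq_sum (I : Subsets n k) : xi I = ∑ J, xiCoeff I J • vBasis n (word J.1) := by
  rw [xi, Finset.smul_sum]
  exact Finset.sum_congr rfl fun J _ => smul_smul _ _ _

lemma repr_xi (I : Subsets n k) (w : Fin n → Fin 2) :
    (vBasis n).repr (xi I) w = ∑ J, if word J.1 = w then xiCoeff I J else 0 := by
  simp only [xi_eq_sum, map_sum, Finsupp.finsetSum_apply, repr_smul_vBasis]

lemma repr_xi_word (I J : Subsets n k) : (vBasis n).repr (xi I) (word J.1) = xiCoeff I J := by
  simp only [repr_xi, word_injective.eq_iff, Subtype.val_inj, Finset.sum_ite_eq', Finset.mem_univ,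
    if_true]

lemma repr_xi_eq_zero (I : Subsets n k) {w : Fin n → Fin 2}
    (hw : ∀ J : Subsets n k, word J.1 ≠ w) : (vBasis n).repr (xi I) w = 0 := by
  simp only [repr_xi, hw, if_false, Finset.sum_const_zero]

lemma xiCoeff_mem_L (I J : Subsets n k) : xiCoeff I J ∈ L n :=
  mul_mem (inv_Q_mem_L I) (WMinus_mem_L I J)

lemma xi_mem_lattice (I : Subsets n k) : xi I ∈ lattice n := by
  rw [mem_lattice_iff]
  intro w
  rw [repr_xi]
  refine sum_mem fun J _ => ?_
  split_ifs
  exacts [xiCoeff_mem_L I J, zero_mem _]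

lemma substZ_xiCoeff (σ : Equiv.Perm (Fin n)) (I J : Subsets n k) :
    substZ σ (xiCoeff I J) = (Q (permSubset σ I) (zF n) (yF n))⁻¹ *
      WMinus J (lamF n) (zF n ∘ elt (permSubset σ I)) (zF n ∘ σ) (yF n) := by
  have hz : (substZ σ : F n →+* F n) ∘ zF n = zF n ∘ σ := funext (substZ_zF σ)
  have hQ := map_Q (substZ σ : F n →+* F n) I (zF n) (yF n)
  have hW := map_WMinus (substZ σ : F n →+* F n) J (lamF n) (zF n ∘ elt I) (zF n) (yF n)
  obtain ⟨π, hπ⟩ := exists_comp_elt_eq σ I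
  rw [← Function.comp_assoc, hz, Function.comp_assoc, hπ, ← Function.comp_assoc,
    WMinus_comp_perm] at hW
  rw [hz, ← Q_permSubset] at hQ
  simp only [RingHom.coe_coe, substZ_lamF, substZ_yF] at hQ hW
  rw [xiCoeff, map_mul, map_inv₀, hQ, hW]

lemma word_eq_iff (J : Finset (Fin n)) (a b : Fin n) :
    word J a = word J b ↔ (a ∈ J ↔ b ∈ J) := by
  by_cases ha : a ∈ J <;> by_cases hb : b ∈ J <;> simp [word, ha, hb]

lemma xiCoeff_permSubset_of_word_eq (hab : a ⋖ b) (I J : Subsets n k)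
    (h : word J.1 a = word J.1 b) :
    xiCoeff (permSubset (Equiv.swap a b) I) J = substZ (Equiv.swap a b) (xiCoeff I J) := by
  rw [substZ_xiCoeff, WMinus_comp_swap hab ((word_eq_iff _ _ _).1 h), xiCoeff]

lemma xiCoeff_permSubset_of_word_ne (hab : a ⋖ b) (I J : Subsets n k)
    (h : word J.1 a ≠ word J.1 b) :
    xiCoeff (permSubset (Equiv.swap a b) I) J =
      dynR (lamF n - yF n * wt b J) (zF n a - zF n b) (yF n)
          (word J.1 a, word J.1 b) (word J.1 a, word J.1 b) *
        substZ (Equiv.swap a b) (xiCoeff I (permSubset (Equiv.swap a b) J)) +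
      dynR (lamF n - yF n * wt b J) (zF n a - zF n b) (yF n)
          (word J.1 a, word J.1 b) (word J.1 b, word J.1 a) *
        substZ (Equiv.swap a b) (xiCoeff I J) := by
  have hlam : lamF n - yF n * wt b J ≠ 0 := by
    convert ne_zero_of_mem_denomsF (lamF_add_mem_denomsF (n := n) (-wt b J)) using 1
    push_cast
    ring
  have hz : zF n a - zF n b - yF n ≠ 0 :=
    ne_zero_of_mem_denomsF (zF_sub_sub_mem_denomsF a b)
  rw [substZ_xiCoeff, substZ_xiCoeff, xiCoeff,
    WMinus_eq_dynR hab (mt (word_eq_iff _ _ _).2 h) _ _ _ _ hlam hz]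
  ring

lemma exchangeOp_xi (hab : a ⋖ b) (I : Subsets n k) :
    exchangeOp a b (xi I) = xi (permSubset (Equiv.swap a b) I) := by
  refine (vBasis n).ext_elem fun w => ?_
  have hwswap (J : Subsets n k) :
      word J.1 ∘ Equiv.swap a b = word (permSubset (Equiv.swap a b) J).1 := by
    rw [word_permSubset, Equiv.swap_inv]
  by_cases hw : ∃ J : Subsets n k, word J.1 = w
  · obtain ⟨J, rfl⟩ := hw
    rw [repr_exchangeOp hab.lt _ _ (m := lamF n - yF n * wt b J) (by rw [wt_eq_sum]), hwswap]
    simp only [repr_xi_word]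
    split_ifs with h
    · rw [xiCoeff_permSubset_of_word_eq hab I J h]
    · rw [xiCoeff_permSubset_of_word_ne hab I J h]
  · push Not at hw
    have hw' (J : Subsets n k) : word J.1 ≠ w ∘ Equiv.swap a b := fun hJ =>
      hw (permSubset (Equiv.swap a b) J) <| by
        rw [← hwswap, hJ, Function.comp_assoc, ← Equiv.coe_trans, Equiv.swap_swap,
          Equiv.coe_refl, Function.comp_id]
    rw [repr_exchangeOp hab.lt _ _ rfl]
    simp only [repr_xi_eq_zero _ hw, repr_xi_eq_zero _ hw', map_zero, mul_zero, add_zero, ite_self]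

lemma linearIndependent_of_triangular {R M ι κ : Type*} [Ring R] [NoZeroDivisors R]
    [AddCommGroup M] [Module R M] [LinearOrder κ] {v : ι → M} (φ : ι → M →ₗ[R] R) (rank : ι → κ)
    (hdiag : ∀ i, φ i (v i) ≠ 0) (hlt : ∀ i j, i ≠ j → φ j (v i) ≠ 0 → rank i < rank j) :
    LinearIndependent R v := by
  classical
  rw [linearIndependent_iff']
  intro s c hc
  by_contra! hne
  obtain ⟨i₀, hi₀, hci₀⟩ := hne
  obtain ⟨j, hj, hmin⟩ := Finset.exists_min_image {i ∈ s | c i ≠ 0} rank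
    ⟨i₀, Finset.mem_filter.2 ⟨hi₀, hci₀⟩⟩
  rw [Finset.mem_filter] at hj
  have hsum : ∑ i ∈ s, c i * φ j (v i) = c j * φ j (v j) := by
    refine Finset.sum_eq_single_of_mem j hj.1 fun i hi hij => ?_
    by_contra hne
    have hci : i ∈ {i ∈ s | c i ≠ 0} := Finset.mem_filter.2 ⟨hi, left_ne_zero_of_mul hne⟩
    exact (hmin i hci).not_gt (hlt i j hij (right_ne_zero_of_mul hne))
  refine mul_ne_zero hj.2 (hdiag j) ?_
  rw [← hsum, ← map_zero (φ j), ← hc, map_sum]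
  simp only [map_smul, smul_eq_mul]

lemma xiCoeff_self_ne_zero (I : Subsets n k) : xiCoeff I I ≠ 0 :=
  mul_ne_zero (inv_ne_zero (Q_ne_zero I)) <|
    WMinus_elt_self_ne_zero I yF_ne_zero zF_injective zF_sub_add_ne_zero fun c =>
      ne_zero_of_mem_denomsF (lamF_add_mem_denomsF c)

lemma sum_rev_lt_sum_rev_of_xiCoeff_ne_zero {I J : Subsets n k} (hIJ : I ≠ J)
    (h : xiCoeff I J ≠ 0) : ∑ j ∈ I.1, (j.rev : ℕ) < ∑ j ∈ J.1, (j.rev : ℕ) := by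
  have hlt := sum_lt_sum_of_WMinus_ne_zero hIJ (right_ne_zero_of_mul h)
  rwa [revSubset, permSubset, Finset.sum_map, revSubset, permSubset, Finset.sum_map] at hlt

lemma linearIndependent_xi : LinearIndependent (F n)
    fun I : Finset (Fin n) => xi (⟨I, rfl⟩ : Subsets n I.card) := by
  refine linearIndependent_of_triangular (fun J => (vBasis n).coord (word J))
    (fun I => ∑ j ∈ I, (j.rev : ℕ)) (fun I => ?_) fun I J hIJ h => ?_
  · rw [Module.Basis.coord_apply, repr_xi_word _ ⟨I, rfl⟩]
    exact xiCoeff_self_ne_zero _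
  · rw [Module.Basis.coord_apply] at h
    by_cases hcard : J.card = I.card
    · rw [repr_xi_word _ ⟨J, hcard⟩] at h
      exact sum_rev_lt_sum_rev_of_xiCoeff_ne_zero (fun h' => hIJ (congrArg Subtype.val h')) h
    · exact absurd (repr_xi_eq_zero _ fun K hK => hcard <| by rw [← word_injective hK, K.2]) h

/-- The basis of the vectors `ξ_I`, for all subsets `I` of all cardinalities. -/
def xiBasis (n : ℕ) : Module.Basis (Finset (Fin n)) (F n) (V n) :=
  basisOfLinearIndependentOfCardEqFinrank linearIndependent_xi (by
    rw [Module.finrank_eq_card_basis (vBasis n), Fintype.card_finset, Fintype.card_fun,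
      Fintype.card_fin, Fintype.card_fin])

lemma xiBasis_apply (I : Subsets n k) : xiBasis n I.1 = xi I := by
  obtain ⟨I, rfl⟩ := I
  rw [xiBasis, coe_basisOfLinearIndependentOfCardEqFinrank]

end Xi

/-! ### The action of the symmetric group -/

section Action

variable {n : ℕ}

/-- The operator which permutes the variables `z_a` and the vectors `ξ_I` by `σ`. -/
def permOp (σ : Equiv.Perm (Fin n)) : Module.End ℂ (V n) where
  toFun v := ∑ I, substZ σ ((xiBasis n).repr v I) • xiBasis n (I.map σ.toEmbedding)
  map_add' u v := by
    simp only [map_add, Finsupp.add_apply, add_smul, Finset.sum_add_distrib]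
  map_smul' c v := by
    rw [RingHom.id_apply, Finset.smul_sum, ← algebraMap_smul (F n) c v]
    refine Finset.sum_congr rfl fun I _ => ?_
    rw [map_smul, Finsupp.smul_apply, smul_eq_mul, map_mul, AlgEquiv.commutes, mul_smul,
      algebraMap_smul]

lemma permOp_smul_xiBasis (σ : Equiv.Perm (Fin n)) (f : F n) (I : Finset (Fin n)) :
    permOp σ (f • xiBasis n I) = substZ σ f • xiBasis n (I.map σ.toEmbedding) := by
  simp only [permOp, LinearMap.coe_mk, AddHom.coe_mk]
  rw [Finset.sum_eq_single I (fun J _ hJI => ?_) fun h => absurd (Finset.mem_univ I) h]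
  · rw [map_smul, Module.Basis.repr_self, Finsupp.smul_single, Finsupp.single_eq_same,
      smul_eq_mul, mul_one]
  · rw [map_smul, Module.Basis.repr_self, Finsupp.smul_single, Finsupp.single_eq_of_ne hJI,
      map_zero, zero_smul]

lemma end_ext_xiBasis {A B : Module.End ℂ (V n)}
    (h : ∀ (f : F n) I, A (f • xiBasis n I) = B (f • xiBasis n I)) : A = B := by
  refine LinearMap.ext fun v => ?_
  rw [← (xiBasis n).sum_repr v, map_sum, map_sum]
  exact Finset.sum_congr rfl fun I _ => h _ _

/-- The action of `S_n` on vector-valued rational functions by the operators `permOp`. -/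
def permAction (n : ℕ) : Equiv.Perm (Fin n) →* Module.End ℂ (V n) where
  toFun := permOp
  map_one' := end_ext_xiBasis fun f I => by
    rw [permOp_smul_xiBasis, substZ_one, Module.End.one_apply]
    exact congrArg (f • xiBasis n ·) Finset.map_refl
  map_mul' σ τ := end_ext_xiBasis fun f I => by
    rw [Module.End.mul_apply, permOp_smul_xiBasis, permOp_smul_xiBasis, permOp_smul_xiBasis,
      substZ_mul, Finset.map_map]
    rfl

lemma mk_covBy_mk_succ {i : ℕ} (hi : i + 1 < n) : (⟨i, by omega⟩ : Fin n) ⋖ ⟨i + 1, hi⟩ :=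
  Fin.covBy_iff.2 (Nat.covBy_iff_add_one_eq.2 rfl)

lemma sTilde_smul {i : ℕ} (hi : i + 1 < n) (f : F n) (v : V n) :
    sTilde i hi (f • v) = substZ (simpleRefl i hi) f • sTilde i hi v := by
  rw [sTilde_eq_exchangeOp]
  exact exchangeOp_smul (mk_covBy_mk_succ hi).lt f v

lemma sTilde_zF_smul {i : ℕ} (hi : i + 1 < n) (a : Fin n) (v : V n) :
    sTilde i hi (zF n a • v) = zF n (simpleRefl i hi a) • sTilde i hi v := by
  rw [sTilde_smul, substZ_zF]

lemma sTilde_xi {k i : ℕ} (hi : i + 1 < n) (I : Subsets n k) :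
    sTilde i hi (xi I) = xi (permSubset (simpleRefl i hi) I) := by
  rw [sTilde_eq_exchangeOp]
  exact exchangeOp_xi (mk_covBy_mk_succ hi) I

lemma sTilde_mem_lattice {i : ℕ} (hi : i + 1 < n) {v : V n} (hv : v ∈ lattice n) :
    sTilde i hi v ∈ lattice n := by
  rw [sTilde_eq_exchangeOp]
  exact exchangeOp_mem_lattice (mk_covBy_mk_succ hi).lt hv

lemma permAction_simpleRefl {i : ℕ} (hi : i + 1 < n) :
    permAction n (simpleRefl i hi) = sTilde i hi :=
  end_ext_xiBasis fun f I => by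
    rw [sTilde_smul, xiBasis_apply ⟨I, rfl⟩, sTilde_xi, ← xiBasis_apply, ← xiBasis_apply]
    exact permOp_smul_xiBasis _ _ _

lemma mclosure_simpleRefl (n : ℕ) :
    Submonoid.closure {σ | ∃ (i : ℕ) (hi : i + 1 < n), σ = simpleRefl i hi} = ⊤ := by
  cases n with
  | zero => exact Subsingleton.elim _ _
  | succ m =>
    refine top_unique ((Equiv.Perm.mclosure_swap_castSucc_succ m).ge.trans
      (Submonoid.closure_mono ?_))
    rintro _ ⟨i, rfl⟩
    exact ⟨i, by omega, rfl⟩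

lemma permAction_mem_lattice (σ : Equiv.Perm (Fin n)) {v : V n} (hv : v ∈ lattice n) :
    permAction n σ v ∈ lattice n := by
  have hσ : σ ∈ Submonoid.closure {σ | ∃ (i : ℕ) (hi : i + 1 < n), σ = simpleRefl i hi} := by
    rw [mclosure_simpleRefl]
    exact Submonoid.mem_top σ
  induction hσ using Submonoid.closure_induction generalizing v with
  | mem σ h =>
    obtain ⟨i, hi, rfl⟩ := h
    rw [permAction_simpleRefl]
    exact sTilde_mem_lattice hi hv
  | one => rwa [map_one]
  | mul σ τ _ _ hσ hτ =>
    rw [map_mul]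
    exact hσ (hτ hv)

lemma eq_permAction {ρ : Equiv.Perm (Fin n) →* Module.End ℂ (V n)}
    (hρ : ∀ (i : ℕ) (hi : i + 1 < n), ρ (simpleRefl i hi) = sTilde i hi) : ρ = permAction n := by
  refine MonoidHom.eq_of_eqOn_denseM (mclosure_simpleRefl n) ?_
  rintro _ ⟨i, hi, rfl⟩
  rw [hρ i hi, permAction_simpleRefl hi]

end Action

section Relations

variable {n i j : ℕ}

lemma swap_braid {α : Type*} [DecidableEq α] {a b c : α} (hab : a ≠ b) (hac : a ≠ c)
    (hbc : b ≠ c) : Equiv.swap b c * (Equiv.swap a b * Equiv.swap b c) =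
      Equiv.swap a b * (Equiv.swap b c * Equiv.swap a b) := by
  rw [← mul_assoc, ← mul_assoc, Equiv.swap_mul_swap_mul_swap hab hac, Equiv.swap_comm a b,
    Equiv.swap_comm b c, Equiv.swap_mul_swap_mul_swap hbc.symm hac.symm, Equiv.swap_comm]

lemma simpleRefl_braid (hi : i + 1 < n) (hi' : i + 1 + 1 < n) :
    simpleRefl (i + 1) hi' * (simpleRefl i hi * simpleRefl (i + 1) hi') =
      simpleRefl i hi * (simpleRefl (i + 1) hi' * simpleRefl i hi) :=
  swap_braid (by simp) (by simp [add_assoc]) (by simp)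

lemma simpleRefl_comm (hi : i + 1 < n) (hj : j + 1 < n) (h : i + 1 < j ∨ j + 1 < i) :
    simpleRefl i hi * simpleRefl j hj = simpleRefl j hj * simpleRefl i hi := by
  rw [simpleRefl, simpleRefl, Equiv.mul_swap_eq_swap_mul, Equiv.swap_apply_of_ne_of_ne,
    Equiv.swap_apply_of_ne_of_ne] <;>
  · rw [ne_eq, Fin.mk.injEq]
    omega

lemma sTilde_comp_self (hi : i + 1 < n) : sTilde i hi ∘ₗ sTilde i hi = LinearMap.id := by
  rw [← permAction_simpleRefl, ← Module.End.mul_eq_comp, ← map_mul, simpleRefl,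
    Equiv.swap_mul_self, map_one, Module.End.one_eq_id]

lemma sTilde_braid (hi : i + 1 < n) (hi' : i + 1 + 1 < n) :
    sTilde (i + 1) hi' ∘ₗ sTilde i hi ∘ₗ sTilde (i + 1) hi' =
      sTilde i hi ∘ₗ sTilde (i + 1) hi' ∘ₗ sTilde i hi := by
  simp only [← permAction_simpleRefl, ← Module.End.mul_eq_comp, ← map_mul, simpleRefl_braid hi hi']

lemma sTilde_comm (hi : i + 1 < n) (hj : j + 1 < n) (h : i + 1 < j ∨ j + 1 < i) :
    sTilde i hi ∘ₗ sTilde j hj = sTilde j hj ∘ₗ sTilde i hi := by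
  simp only [← permAction_simpleRefl, ← Module.End.mul_eq_comp, ← map_mul,
    simpleRefl_comm hi hj h]

end Relations

end DynXi

end

theorem mainTheorem8 (n : ℕ) :
    -- the relations of the simple transpositions
    (∀ (i : ℕ) (hi : i + 1 < n), DynXi.sTilde i hi ∘ₗ DynXi.sTilde i hi = LinearMap.id) ∧
    (∀ (i : ℕ) (hi : i + 2 < n),
      DynXi.sTilde (i + 1) hi ∘ₗ DynXi.sTilde i (by omega) ∘ₗ DynXi.sTilde (i + 1) hi =
        DynXi.sTilde i (by omega) ∘ₗ DynXi.sTilde (i + 1) hi ∘ₗ DynXi.sTilde i (by omega)) ∧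
    (∀ (i j : ℕ) (hi : i + 1 < n) (hj : j + 1 < n), i + 1 < j ∨ j + 1 < i →
      DynXi.sTilde i hi ∘ₗ DynXi.sTilde j hj = DynXi.sTilde j hj ∘ₗ DynXi.sTilde i hi) ∧
    -- the commutation relations with multiplication by `z_a`
    (∀ (i : ℕ) (hi : i + 1 < n) (a : Fin n) (v : DynXi.V n),
      DynXi.sTilde i hi (DynXi.zF n a • v) =
        DynXi.zF n (DynXi.simpleRefl i hi a) • DynXi.sTilde i hi v) ∧
    -- every `ξ_I` has its coefficients in `L_{λ,z,y}`
    (∀ (k : ℕ) (I : DynXi.Subsets n k), DynXi.xi I ∈ DynXi.lattice n) ∧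
    -- there is a unique action of `S_n` in which `s_i` acts by `s̃_i`
    ∃ ρ : Equiv.Perm (Fin n) →* Module.End ℂ (DynXi.V n),
      (∀ (i : ℕ) (hi : i + 1 < n), ρ (DynXi.simpleRefl i hi) = DynXi.sTilde i hi) ∧
      (∀ ρ' : Equiv.Perm (Fin n) →* Module.End ℂ (DynXi.V n),
        (∀ (i : ℕ) (hi : i + 1 < n), ρ' (DynXi.simpleRefl i hi) = DynXi.sTilde i hi) → ρ' = ρ) ∧
      -- it preserves the vectors with coefficients in `L_{λ,z,y}`
      (∀ (σ : Equiv.Perm (Fin n)), ∀ v ∈ DynXi.lattice n, ρ σ v ∈ DynXi.lattice n) ∧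
      -- and it permutes the vectors `ξ_I`
      (∀ (k : ℕ) (I : DynXi.Subsets n k) (i : ℕ) (hi : i + 1 < n),
        DynXi.xi (DynXi.permSubset (DynXi.simpleRefl i hi) I) =
          DynXi.sTilde i hi (DynXi.xi I)) := by
  refine ⟨fun i hi => ?_, fun i hi => ?_, fun i j hi hj hij => ?_, fun i hi a v => ?_,
    fun k I => ?_, DynXi.permAction n, fun i hi => ?_, fun ρ' hρ' => ?_, fun σ v hv => ?_,
    fun k I i hi => ?_⟩
  · exact DynXi.sTilde_comp_self hi
  · exact DynXi.sTilde_braid _ hi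
  · exact DynXi.sTilde_comm hi hj hij
  · exact DynXi.sTilde_zF_smul hi a v
  · exact DynXi.xi_mem_lattice I
  · exact DynXi.permAction_simpleRefl hi
  · exact DynXi.eq_permAction hρ'
  · exact DynXi.permAction_mem_lattice σ hv
  · exact (DynXi.sTilde_xi hi I).symm
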